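/- **Setting.** Let $n\ge 1$, $C\subset\mathbb R^n$, and let $r:[0,\infty)\to\mathbb R$ be piecewise continuous: right-continuous, with left limits, and with a locally finite set of discontinuities. Consider the switched system $$\dot x=f(x,r(t)),\qquad x\in C,\ t\ge 0. \tag{1}$$ A (Carathéodory) solution from time $t_0\ge0$ is a curve $x:[t_0,\infty)\to C$ with $x(t)=x(t_0)+\int_{t_0}^t f(x(s),r(s))\,ds$ for all $t\ge t_0$. *(H1)* $f(x,\rho)$ is continuous in $(x,\rho)\in C\times\mathbb R$; it is differentiable with respect to $x\in C$ (within $C$), with Jacobian $\frac{\partial f}{\partial x}(x,\rho)$ continuous in $(x,\rho)\in C\times\mathbb R$; and $|f(x,r(t))|\le m(t)$ for all $x\in C$, $t\ge0$, with a Lebesgue measurable function $m$. *(H2)* For every $t\ge 0$ a norm $|\cdot|_{\chi(t)}$ on $\mathbb R^n$ is given, and there is a locally finite set of jump times $\{\tilde t_j\}\subset[0,\infty)$ such that: - the norm is right-regular at each $t\notin\{\tilde t_j\}$, i.e. $\limsup_{h\to0+}\sup_{|x|_{\chi(t)}=1}\frac{|x|_{\chi(t+h)}-1}{h}$ is finite;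 - for each $x$, $t\mapsto|x|_{\chi(t)}$ is right-continuous, is also left-continuous at every $t>0$ that is not a jump time, and has a left limit $|x|_{\chi(\tilde t_j-)}$ at every jump time $\tilde t_j>0$; - there is $D>0$ with $|x|_{\chi(t)}\le D|x|_{\chi(s)}$ for all $x\in\mathbb R^n$, $s,t\ge0$. *(H3)* $C$ is forward invariant (for all $t_0\ge0$, $x_0\in C$ there is a solution from time $t_0$, with values in $C$, and $x(t_0)=x_0$) and $\kappa$-reachable for some $\kappa>0$: for all $t_0\ge0$ and $x_0,y_0\in C$ there is a $C^1$ curve $\gamma:[0,1]\to C$ with $\gamma(0)=x_0$, $\gamma(1)=y_0$, $|\gamma'(s)|_{\chi(t_0)}\le\kappa|x_0-y_0|_{\chi(t_0)}$ for all $s\in[0,1]$. The switched matrix measure of $A\in\mathbb R^{n\times n}$ is $\nu_{\chi(t)}(A)=\limsup_{h\to0+}\frac1h\sup_{|x|_{\chi(t)}=1}\big[|(I_n+hA)x|_{\chi(t+h)}-1\big]$. A function $\beta:[0,\infty)^2\to[0,\infty)$ is of class $\mathcal{EKL}$ if it is continuous, $\beta(\cdot,t)$ is strictly increasing with $\beta(0,t)=0$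 for each $t$, $\beta(\rho,\cdot)$ is nonincreasing with limit $0$ for each $\rho$, and $\beta(\rho,t)=O(e^{-\lambda t})$ as $t\to\infty$ for each $\rho$, with some $\lambda>0$. System (1) is $\delta$EAS in $C$ if for some norm $|\cdot|$ and for every $t_0\ge0$ there is $\beta$ of class $\mathcal{EKL}$ with $|x(t_0+t)-y(t_0+t)|\le\beta(|x(t_0)-y(t_0)|,t)$ for all $t\ge0$ and all solutions $x,y$ from time $t_0$ in $C$; it is $\delta$UEAS in $C$ if $\beta$ can be chosen independently of $t_0$. **Theorem.** Assume (H1)–(H3). Let $\alpha:[0,\infty)\to\mathbb R$ be measurable and locally integrable, and let $\beta_j\ge0$ be constants, such that $$\nu_{\chi(t)}\Big(\frac{\partial f}{\partial x}(x,r(t))\Big)\le\alpha(t)\quad\text{for all }t\notin\{\tilde t_j\},\ x\in C,\qquad |\cdot|_{\chi(\tilde t_j)}\le\beta_j\,|\cdot|_{\chi(\tilde t_j-)}\quad\text{for all }j\text{ with }\tilde t_j>0.$$ For $t_0\ge0$, $T\ge0$ put $\Lambda(t_0,T)=\int_{t_0}^{t_0+T}\alpha(t)\,dt+\sum_{j:\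 t_0<\tilde t_j<t_0+T}\log\beta_j$, and consider the condition $$\frac1T\,\Lambda(t_0,T)<-c\qquad\text{for all }T>T_0. \tag{2}$$ 1. If (2) holds for some $t_0\ge0$, $c>0$, $T_0>0$, then (1) is $\delta$EAS in $C$. Moreover, whenever (2) holds for $t_0\ge 0$, $c>0$, $T_0>0$, there is $K>0$ such that $|x(t)-y(t)|\le Ke^{-c(t-t_0)}|x(t_0)-y(t_0)|$ (Euclidean norm) for all $t\ge t_0$ and all solutions $x,y$ from time $t_0$ in $C$. 2. If (2) holds for all $t_0\ge0$ with $c>0$ and $T_0>0$ independent of $t_0$, then there is $K>0$ independent of $t_0$ such that, for every $t_0\ge 0$, the last estimate holds for all $t>t_0+T_0$. If, in addition, $\Lambda(t_0,T)$ is bounded above uniformly in $t_0\ge0$ and $0\le T\le T_0$, then (1) is $\delta$UEAS in $C$, and the estimate holds for all $t_0\ge0$ and $t\ge t_0$ with $K$ independent of $t_0$. -/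

import Mathlib

open Set Filter Topology MeasureTheory

noncomputable section

namespace SwitchedContraction

/-- The state space `ℝⁿ`. -/
abbrev State (n : ℕ) : Type := EuclideanSpace ℝ (Fin n)

variable {n : ℕ}

/-- A seminorm on `ℝⁿ` that is a norm. -/
def IsNorm (p : Seminorm ℝ (State n)) : Prop := ∀ x, p x = 0 → x = 0

/-- A set of time instants that is locally finite in `[0, ∞)`. -/
def LocallyFiniteTimes (S : Set ℝ) : Prop := ∀ T : ℝ, (S ∩ Icc 0 T).Finite

/-- Piecewise continuous signals on `[0, ∞)`: right-continuous, with left limits, and with a locally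
finite set of discontinuities. -/
structure IsPWC (r : ℝ → ℝ) : Prop where
  rightCont : ∀ t, 0 ≤ t → Tendsto r (𝓝[>] t) (𝓝 (r t))
  leftLim : ∀ t, 0 < t → ∃ l, Tendsto r (𝓝[<] t) (𝓝 l)
  discont : ∃ S, LocallyFiniteTimes S ∧ ∀ t, 0 < t → t ∉ S → ContinuousAt r t

/-! ### The switched system -/

/-- Regularity of the vector field `f(x, ρ)`, `x ∈ C`, with Jacobian `J(x, ρ) = ∂f/∂x (x, ρ)`, driven
by the signal `r`. The set `C` need not be open, so the derivative is taken within `C`. -/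
structure FieldHyp (C : Set (State n)) (f : State n → ℝ → State n)
    (J : State n → ℝ → (State n →L[ℝ] State n)) (r : ℝ → ℝ) : Prop where
  cont : ContinuousOn (fun q : State n × ℝ => f q.1 q.2) (C ×ˢ univ)
  hasDeriv : ∀ x ∈ C, ∀ ρ : ℝ, HasFDerivWithinAt (fun y => f y ρ) (J x ρ) C x
  contDeriv : ContinuousOn (fun q : State n × ℝ => J q.1 q.2) (C ×ˢ univ)
  bound : ∃ m : ℝ → ℝ, AEMeasurable m volume ∧ ∀ x ∈ C, ∀ t, 0 ≤ t → ‖f x (r t)‖ ≤ m t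

/-- `x` is a Carathéodory solution on `[t₀, ∞)` of `ẋ = f(x, r(t))`, the field being given on `C`:
the curve stays in `C` and satisfies the integral equation. -/
structure IsSolution (C : Set (State n)) (f : State n → ℝ → State n) (r : ℝ → ℝ) (t₀ : ℝ)
    (x : ℝ → State n) : Prop where
  mem : ∀ t, t₀ ≤ t → x t ∈ C
  integrable : ∀ t, t₀ ≤ t → IntervalIntegrable (fun s => f (x s) (r s)) volume t₀ t
  eq : ∀ t, t₀ ≤ t → x t = x t₀ + ∫ s in t₀..t, f (x s) (r s)

/-- `C` is forward invariant: from every initial time and every initial point in `C` the system can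
be solved for all later times inside `C`. -/
def ForwardInvariant (C : Set (State n)) (f : State n → ℝ → State n) (r : ℝ → ℝ) : Prop :=
  ∀ t₀, 0 ≤ t₀ → ∀ x₀ ∈ C, ∃ x, IsSolution C f r t₀ x ∧ x t₀ = x₀

/-- `κ`-reachable sets, with respect to the norm `p`. -/
def IsKappaReachable (p : Seminorm ℝ (State n)) (κ : ℝ) (C : Set (State n)) : Prop :=
  ∀ x₀ ∈ C, ∀ y₀ ∈ C, ∃ γ : ℝ → State n,
    ContDiffOn ℝ 1 γ (Icc 0 1) ∧ MapsTo γ (Icc 0 1) C ∧ γ 0 = x₀ ∧ γ 1 = y₀ ∧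
    ∀ s ∈ Icc (0 : ℝ) 1, p (derivWithin γ (Icc 0 1) s) ≤ κ * p (x₀ - y₀)

/-! ### Multiple norms: `N t` is the norm `|·|_{χ(t)}` -/

/-- The left limit `|x|_{χ(t-)}`. -/
def leftNorm (N : ℝ → Seminorm ℝ (State n)) (t : ℝ) (x : State n) : ℝ :=
  Function.leftLim (fun s => N s x) t

/-- The switched matrix measure `ν_{χ(t)}(A)`, as an extended real number. -/
def switchedMeasure (N : ℝ → Seminorm ℝ (State n)) (t : ℝ) (A : State n →L[ℝ] State n) : EReal :=
  limsup (fun h : ℝ => ⨆ x ∈ {x : State n | N t x = 1},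
    (((N (t + h) (x + h • A x) - 1) / h : ℝ) : EReal)) (𝓝[>] 0)

/-- The upper right partial differential of the switched norm, as an extended real number. -/
def normDifferential (N : ℝ → Seminorm ℝ (State n)) (t : ℝ) : EReal :=
  limsup (fun h : ℝ => ⨆ x ∈ {x : State n | N t x = 1},
    (((N (t + h) x - 1) / h : ℝ) : EReal)) (𝓝[>] 0)

/-- Right regularity at `t`: the upper right partial differential exists (is finite). -/
def RightRegularAt (N : ℝ → Seminorm ℝ (State n)) (t : ℝ) : Prop :=
  ∃ L : ℝ, normDifferential N t = (L : EReal)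

/-- Hypotheses on the multiple norm with jump times `S`. -/
structure NormHyp (N : ℝ → Seminorm ℝ (State n)) (S : Set ℝ) : Prop where
  isNorm : ∀ t, 0 ≤ t → IsNorm (N t)
  jumps : LocallyFiniteTimes S
  rightRegular : ∀ t, 0 ≤ t → t ∉ S → RightRegularAt N t
  rightCont : ∀ t, 0 ≤ t → ∀ x, Tendsto (fun s => N s x) (𝓝[>] t) (𝓝 (N t x))
  /-- Outside of the jump times the norm does not jump. -/
  leftCont : ∀ t, 0 < t → t ∉ S → ∀ x, Tendsto (fun s => N s x) (𝓝[<] t) (𝓝 (N t x))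
  leftLim : ∀ t, 0 < t → t ∈ S → ∀ x, ∃ l, Tendsto (fun s => N s x) (𝓝[<] t) (𝓝 l)
  equivalent : ∃ D > 0, ∀ t, 0 ≤ t → ∀ s, 0 ≤ s → ∀ x, N t x ≤ D * N s x

/-- `∫_{t₀}^{t₀+T} α(t) dt + ∑ log β_j`, the sum being over the jump times in `(t₀, t₀ + T)`.
The factor that belongs to the jump time `τ` is `β τ`. -/
def accumulated (α β : ℝ → ℝ) (S : Set ℝ) (t₀ T : ℝ) : ℝ :=
  (∫ t in t₀..(t₀ + T), α t) + ∑ᶠ τ ∈ S ∩ Ioo t₀ (t₀ + T), Real.log (β τ)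

/-- The average condition at `t₀`. -/
def AverageCond (α β : ℝ → ℝ) (S : Set ℝ) (c T₀ t₀ : ℝ) : Prop :=
  ∀ T > T₀, 1 / T * accumulated α β S t₀ T < -c

/-! ### Incremental stability -/

/-- Class `𝒦` functions on `[0, ∞)`. -/
structure IsClassK (a : ℝ → ℝ) : Prop where
  cont : ContinuousOn a (Ici 0)
  strictMono : StrictMonoOn a (Ici 0)
  zero : a 0 = 0

/-- Class `𝒦ℒ` functions on `[0, ∞) × [0, ∞)`. -/
structure IsClassKL (b : ℝ → ℝ → ℝ) : Prop where
  cont : ContinuousOn (fun q : ℝ × ℝ => b q.1 q.2) (Ici 0 ×ˢ Ici 0)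
  classK : ∀ t, 0 ≤ t → IsClassK (fun ρ => b ρ t)
  anti : ∀ ρ, 0 ≤ ρ → AntitoneOn (b ρ) (Ici 0)
  tendsto : ∀ ρ, 0 ≤ ρ → Tendsto (b ρ) atTop (𝓝 0)

/-- Class `ℰ𝒦ℒ` functions: class `𝒦ℒ`, with exponential decay. -/
def IsClassEKL (b : ℝ → ℝ → ℝ) : Prop :=
  IsClassKL b ∧ ∃ c > 0, ∀ ρ, 0 ≤ ρ → (b ρ) =O[atTop] fun t => Real.exp (-c * t)

/-- `|φ(t₀ + t; t₀, x₀) - φ(t₀ + t; t₀, y₀)| ≤ b(|x₀ - y₀|, t)` for all `x₀, y₀ ∈ C`, `t ≥ 0`. -/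
def IncrementalBound (C : Set (State n)) (f : State n → ℝ → State n) (r : ℝ → ℝ)
    (p : Seminorm ℝ (State n)) (b : ℝ → ℝ → ℝ) (t₀ : ℝ) : Prop :=
  ∀ x y, IsSolution C f r t₀ x → IsSolution C f r t₀ y →
    ∀ t, 0 ≤ t → p (x (t₀ + t) - y (t₀ + t)) ≤ b (p (x t₀ - y t₀)) t

/-- Incremental exponential asymptotic stability. -/
def DeltaEAS (C : Set (State n)) (f : State n → ℝ → State n) (r : ℝ → ℝ) : Prop :=
  ∃ p : Seminorm ℝ (State n), IsNorm p ∧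
    ∀ t₀, 0 ≤ t₀ → ∃ b, IsClassEKL b ∧ IncrementalBound C f r p b t₀

/-- Incremental uniform exponential asymptotic stability. -/
def DeltaUEAS (C : Set (State n)) (f : State n → ℝ → State n) (r : ℝ → ℝ) : Prop :=
  ∃ p : Seminorm ℝ (State n), IsNorm p ∧
    ∃ b, IsClassEKL b ∧ ∀ t₀, 0 ≤ t₀ → IncrementalBound C f r p b t₀

/-- Any two solutions in `C` that start at time `t₀` satisfy
`|x(t) - y(t)| ≤ K exp(-c (t - t₀)) |x(t₀) - y(t₀)|` for all `t ≥ t₀ + T₁`. -/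
def ExpEstimate (C : Set (State n)) (f : State n → ℝ → State n) (r : ℝ → ℝ)
    (K c T₁ t₀ : ℝ) : Prop :=
  ∀ x y, IsSolution C f r t₀ x → IsSolution C f r t₀ y →
    ∀ t, t₀ + T₁ ≤ t → ‖x t - y t‖ ≤ K * Real.exp (-c * (t - t₀)) * ‖x t₀ - y t₀‖

end SwitchedContraction

end

/-! The difference `w` of a fixed solution `x` and a nearby solution `z` satisfies `w' = J(x, r) w +
o(|w|)`, uniformly on compact time intervals. The matrix measure therefore bounds the upper right
Dini derivative of `log N t (w t)` by `α + η` off the jump times, while a jump at `τ` adds at most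
`log β τ`. Integrating gives contraction by `exp (Λ + η (t₁ - t₀))` for all `z` that start close
enough to `x` (`exists_local_contraction`). The integration rests on `sub_le_integral_add_jumps`,
which needs no more of `α` than integrability, and the derivative bound on `log_norm_dini_le`.

To compare distant solutions, join their initial points by a curve in `C` of speed at most `κ |x₀ -
y₀|` and solve from each of its points. The map from the curve parameter to the state at time `t₁`
satisfies, around each parameter, a Lipschitz bound centred there with a constant common to all
parameters. Such bounds add up along the interval (`norm_sub_le_of_eventually_norm_sub_le`), so
neither differentiability of the flow nor a variational equation is needed. The outcome,
`exists_contraction`, has a constant that depends on neither the times nor the solutions.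

What remains is bookkeeping for `accumulated`: the average condition gives `Λ(t₀, T) ≤ M - c T`,
hence exponential decay, and `Λ` is additive in time up to a single jump term, so such a bound moves
to every other initial time. -/

noncomputable section

namespace SwitchedContraction

variable {n : ℕ}

/-! ### Comparison of a function with the integral of a bound on its upper right Dini derivative -/

/-- If the upper right Dini derivative of a continuous function is bounded by an integrable function
everywhere, then the increment of the function is bounded by the integral. -/
theorem sub_le_integral_of_dini_le {g φ : ℝ → ℝ} {a b : ℝ} (hab : a ≤ b)
    (hcont : ContinuousOn g (Icc a b))
    (hdini : ∀ t ∈ Ico a b, ∀ y > φ t, ∀ᶠ u in 𝓝[>] t, g u - g t ≤ (u - t) * y)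
    (φint : IntegrableOn φ (Icc a b)) : g b - g a ≤ ∫ y in a..b, φ y := by
  refine le_of_forall_pos_le_add fun ε εpos => ?_
  -- Vitali–Carathéodory: a lower semicontinuous `G > φ` with almost the same integral. Lower
  -- semicontinuity keeps `G` above some `y > φ t` on a whole neighbourhood of `t`, so the bound by
  -- the integral of `G` propagates to the right.
  rcases exists_lt_lowerSemicontinuous_integral_lt φ φint εpos with
    ⟨G, f_lt_G, Gcont, Gint, Glt_top, hG⟩
  have hint : ∀ u ∈ Icc a b, ∀ v ∈ Icc a b, u ≤ v →
      IntervalIntegrable (fun w => (G w).toReal) volume u v := fun u hu v hv huv => by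
    rw [intervalIntegrable_iff_integrableOn_Ioc_of_le huv]
    exact IntegrableOn.mono_set Gint (Ioc_subset_Icc_self.trans (Icc_subset_Icc hu.1 hv.2))
  set s := {t | g t - g a ≤ ∫ u in a..t, (G u).toReal} ∩ Icc a b
  have s_closed : IsClosed s := by
    have : ContinuousOn (fun t => (g t - g a, ∫ u in a..t, (G u).toReal)) (Icc a b) := by
      rw [← uIcc_of_le hab] at Gint hcont ⊢
      exact (hcont.sub continuousOn_const).prodMk
        (intervalIntegral.continuousOn_primitive_interval Gint)
    simp only [s, inter_comm]
    exact this.preimage_isClosed_of_isClosed isClosed_Icc OrderClosedTopology.isClosed_le'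
  have main : Icc a b ⊆ {t | g t - g a ≤ ∫ u in a..t, (G u).toReal} := by
    refine s_closed.Icc_subset_of_forall_exists_gt
      (by simp only [intervalIntegral.integral_same, mem_ofPred_eq, sub_self, le_rfl])
      fun t ht v t_lt_v => ?_
    obtain ⟨y, φ_lt_y, y_lt_G⟩ : ∃ y : ℝ, (φ t : EReal) < y ∧ (y : EReal) < G t :=
      EReal.lt_iff_exists_real_btwn.1 (f_lt_G t)
    have I1 : ∀ᶠ u in 𝓝[>] t, (u - t) * y ≤ ∫ w in t..u, (G w).toReal := by
      have B : ∀ᶠ u in 𝓝 t, (y : EReal) < G u := Gcont.lowerSemicontinuousAt _ _ y_lt_G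
      rcases mem_nhds_iff_exists_Ioo_subset.1 B with ⟨m, M, ⟨hm, hM⟩, H⟩
      have : Ioo t (min M b) ∈ 𝓝[>] t := Ioo_mem_nhdsGT (lt_min hM ht.right.right)
      filter_upwards [this] with u hu
      have I : Icc t u ⊆ Icc a b := Icc_subset_Icc ht.2.1 (hu.2.le.trans (min_le_right _ _))
      calc
        (u - t) * y = ∫ _ in Icc t u, y := by
          simp only [MeasureTheory.integral_const, MeasurableSet.univ, measureReal_restrict_apply,
            univ_inter, hu.left.le, Real.volume_real_Icc_of_le, smul_eq_mul]
        _ ≤ ∫ w in t..u, (G w).toReal := by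
          rw [intervalIntegral.integral_of_le hu.1.le, ← integral_Icc_eq_integral_Ioc]
          apply setIntegral_mono_ae_restrict
          · simp
          · exact IntegrableOn.mono_set Gint I
          · have C1 : ∀ᵐ x : ℝ ∂volume.restrict (Icc t u), G x < ⊤ :=
              ae_mono (Measure.restrict_mono I le_rfl) Glt_top
            have C2 : ∀ᵐ x : ℝ ∂volume.restrict (Icc t u), x ∈ Icc t u :=
              ae_restrict_mem measurableSet_Icc
            filter_upwards [C1, C2] with x Gx hx
            apply EReal.coe_le_coe_iff.1
            have : x ∈ Ioo m M := by
              simp only [hm.trans_le hx.left,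
                (hx.right.trans_lt hu.right).trans_le (min_le_left M b), mem_Ioo, and_self_iff]
            refine (H this).out.le.trans_eq ?_
            exact (EReal.coe_toReal Gx.ne (f_lt_G x).ne_bot).symm
    have I2 : ∀ᶠ u in 𝓝[>] t, g u - g t ≤ (u - t) * y :=
      hdini t ht.2 y (EReal.coe_lt_coe_iff.1 φ_lt_y)
    have I3 : ∀ᶠ u in 𝓝[>] t, g u - g t ≤ ∫ w in t..u, (G w).toReal := by
      filter_upwards [I1, I2] with u hu1 hu2 using hu2.trans hu1
    have I4 : ∀ᶠ u in 𝓝[>] t, u ∈ Ioc t (min v b) := Ioc_mem_nhdsGT <| lt_min t_lt_v ht.2.2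
    rcases (I3.and I4).exists with ⟨x, hx, h'x⟩
    refine ⟨x, ?_, Ioc_subset_Ioc le_rfl (min_le_left _ _) h'x⟩
    have hxb : x ∈ Icc a b := ⟨ht.2.1.trans h'x.1.le, h'x.2.trans (min_le_right _ _)⟩
    calc
      g x - g a = g t - g a + (g x - g t) := by abel
      _ ≤ (∫ w in a..t, (G w).toReal) + ∫ w in t..x, (G w).toReal := add_le_add ht.1 hx
      _ = ∫ w in a..x, (G w).toReal :=
        intervalIntegral.integral_add_adjacent_intervals
          (hint a (left_mem_Icc.2 hab) t ⟨ht.2.1, ht.2.2.le⟩ ht.2.1)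
          (hint t ⟨ht.2.1, ht.2.2.le⟩ x hxb h'x.1.le)
  calc
    g b - g a ≤ ∫ y in a..b, (G y).toReal := main (right_mem_Icc.2 hab)
    _ ≤ (∫ y in a..b, φ y) + ε := by
      convert! hG.le <;>
        · rw [intervalIntegral.integral_of_le hab]
          simp only [integral_Icc_eq_integral_Ioc', Real.volume_singleton]

/-- The comparison on an open interval, with one-sided limits at its ends. -/
theorem sub_le_integral_of_dini_le_Ioo {g φ : ℝ → ℝ} {a b l : ℝ} (hab : a < b)
    (hcont : ContinuousOn g (Ioo a b))
    (hdini : ∀ t ∈ Ioo a b, ∀ y > φ t, ∀ᶠ u in 𝓝[>] t, g u - g t ≤ (u - t) * y)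
    (φint : IntegrableOn φ (Icc a b)) (ha : Tendsto g (𝓝[>] a) (𝓝 (g a)))
    (hb : Tendsto g (𝓝[<] b) (𝓝 l)) : l - g a ≤ ∫ y in a..b, φ y := by
  set Φ : ℝ → ℝ := fun t => ∫ y in a..t, φ y with hΦ
  have hΦc : ContinuousOn Φ (Icc a b) := by
    rw [← uIcc_of_le hab.le] at φint ⊢
    exact intervalIntegral.continuousOn_primitive_interval φint
  have hint : ∀ u ∈ Icc a b, ∀ v ∈ Icc a b, u ≤ v → IntervalIntegrable φ volume u v :=
    fun u hu v hv huv => by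
      rw [intervalIntegrable_iff_integrableOn_Ioc_of_le huv]
      exact φint.mono_set (Ioc_subset_Icc_self.trans (Icc_subset_Icc hu.1 hv.2))
  have hanti : ∀ u ∈ Ioo a b, ∀ v ∈ Ioo a b, u ≤ v → g v - Φ v ≤ g u - Φ u := by
    intro u hu v hv huv
    have h1 := sub_le_integral_of_dini_le huv
      (hcont.mono (Icc_subset_Ioo hu.1 hv.2))
      (fun t ht => hdini t ⟨hu.1.trans_le ht.1, ht.2.trans hv.2⟩)
      (φint.mono_set (Icc_subset_Icc hu.1.le hv.2.le))
    have h2 : Φ u + ∫ y in u..v, φ y = Φ v :=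
      intervalIntegral.integral_add_adjacent_intervals
        (hint a (left_mem_Icc.2 hab.le) u (Ioo_subset_Icc_self hu) hu.1.le)
        (hint u (Ioo_subset_Icc_self hu) v (Ioo_subset_Icc_self hv) huv)
    linarith
  -- Both limits of the antitone function `g - Φ`, at `a+` and at `b-`, are compared with its value
  -- at one interior point.
  obtain ⟨m, hm⟩ := exists_between hab
  have hΦa : Tendsto Φ (𝓝[>] a) (𝓝 (Φ a)) :=
    ((hΦc a (left_mem_Icc.2 hab.le)).mono_of_mem_nhdsWithin (Icc_mem_nhdsGT hab))
  have hΦb : Tendsto Φ (𝓝[<] b) (𝓝 (Φ b)) :=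
    ((hΦc b (right_mem_Icc.2 hab.le)).mono_of_mem_nhdsWithin (Icc_mem_nhdsLT hab))
  have h1 : g m - Φ m ≤ g a - Φ a := ge_of_tendsto (ha.sub hΦa) <| by
    filter_upwards [Ioo_mem_nhdsGT hm.1] with u hu
    exact hanti u ⟨hu.1, hu.2.trans hm.2⟩ m hm hu.2.le
  have h2 : l - Φ b ≤ g m - Φ m := le_of_tendsto (hb.sub hΦb) <| by
    filter_upwards [Ioo_mem_nhdsLT hm.2] with u hu
    exact hanti m hm u ⟨hm.1.trans hu.1, hu.2⟩ hu.1.le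
  have h3 : Φ a = 0 := by simp [hΦ]
  change l - g a ≤ Φ b
  linarith

theorem finsum_mem_inter_Ioc_add {S : Set ℝ} {a b c : ℝ} (hab : a ≤ b) (hbc : b ≤ c)
    (hS : (S ∩ Icc a c).Finite) (w : ℝ → ℝ) :
    ∑ᶠ τ ∈ S ∩ Ioc a b, w τ + ∑ᶠ τ ∈ S ∩ Ioc b c, w τ = ∑ᶠ τ ∈ S ∩ Ioc a c, w τ := by
  rw [← Ioc_union_Ioc_eq_Ioc hab hbc, inter_union_distrib_left, finsum_mem_union]
  · refine Set.disjoint_left.2 fun x hx hx' => ?_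
    exact absurd hx.2.2 (not_le.2 hx'.2.1)
  · exact hS.subset (inter_subset_inter_right _ fun x hx => ⟨hx.1.le, hx.2.trans hbc⟩)
  · exact hS.subset (inter_subset_inter_right _ fun x hx => ⟨hab.trans hx.1.le, hx.2⟩)

/-- The comparison for functions with finitely many jumps. -/
theorem sub_le_integral_add_jumps {g φ w : ℝ → ℝ} {S : Set ℝ} {A B : ℝ}
    (hS : (S ∩ Icc A B).Finite)
    (hright : ∀ t ∈ Ico A B, Tendsto g (𝓝[>] t) (𝓝 (g t)))
    (hleft : ∀ t ∈ Ioc A B, ∃ l, Tendsto g (𝓝[<] t) (𝓝 l) ∧ (t ∉ S → l = g t) ∧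
      (t ∈ S → g t ≤ l + w t))
    (hdini : ∀ t ∈ Ioo A B, t ∉ S → ∀ y > φ t, ∀ᶠ u in 𝓝[>] t, g u - g t ≤ (u - t) * y)
    (φint : IntegrableOn φ (Icc A B)) {a b : ℝ} (ha : A ≤ a) (hab : a < b) (hb : b ≤ B) :
    g b - g a ≤ (∫ t in a..b, φ t) + ∑ᶠ τ ∈ S ∩ Ioc a b, w τ := by
  -- The induction counts interior jumps only. A jump at `b` is treated in the base case and one at
  -- `a` belongs to the preceding interval, so splitting at `τ` counts it once.
  induction hk : (S ∩ Ioo a b).ncard using Nat.strong_induction_on generalizing a b with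
  | _ k ih =>
  have hfin : (S ∩ Ioo a b).Finite :=
    hS.subset (inter_subset_inter_right _ fun x hx => ⟨ha.trans hx.1.le, hx.2.le.trans hb⟩)
  rcases (S ∩ Ioo a b).eq_empty_or_nonempty with he | ⟨τ, hτS, hτ⟩
  · have hnot : ∀ t ∈ Ioo a b, t ∉ S := fun t ht hts => by
      have : t ∈ S ∩ Ioo a b := ⟨hts, ht⟩
      simp [he] at this
    obtain ⟨l, hl, hl1, hl2⟩ := hleft b ⟨ha.trans_lt hab, hb⟩
    have key : l - g a ≤ ∫ t in a..b, φ t := by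
      refine sub_le_integral_of_dini_le_Ioo hab (fun t ht => ?_) (fun t ht =>
        hdini t ⟨ha.trans_lt ht.1, ht.2.trans_le hb⟩ (hnot t ht))
        (φint.mono_set (Icc_subset_Icc ha hb)) (hright a ⟨ha, hab.trans_le hb⟩) hl
      obtain ⟨l', hl', hl1', -⟩ := hleft t ⟨ha.trans_lt ht.1, ht.2.le.trans hb⟩
      rw [hl1' (hnot t ht)] at hl'
      have h2 := hright t ⟨ha.trans ht.1.le, ht.2.trans_le hb⟩
      exact (continuousAt_iff_continuous_left'_right'.2 ⟨hl', h2⟩).continuousWithinAt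
    by_cases hbS : b ∈ S
    · have : S ∩ Ioc a b = {b} := by
        ext t
        refine ⟨fun ht => ?_, fun ht => ?_⟩
        · by_contra hne
          exact hnot t ⟨ht.2.1, lt_of_le_of_ne ht.2.2 hne⟩ ht.1
        · rw [mem_singleton_iff.1 ht]
          exact ⟨hbS, hab, le_rfl⟩
      rw [this, finsum_mem_singleton]
      linarith [hl2 hbS]
    · have : S ∩ Ioc a b = ∅ := by
        refine eq_empty_of_forall_notMem fun t ht => ?_
        exact hnot t ⟨ht.2.1, lt_of_le_of_ne ht.2.2 fun h => hbS (h ▸ ht.1)⟩ ht.1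
      rw [this, finsum_mem_empty, ← hl1 hbS]
      linarith
  · have hlt : ∀ c d : ℝ, a ≤ c → d ≤ b → (τ = c ∨ τ = d) → (S ∩ Ioo c d).ncard < k := by
      intro c d hc hd hcd
      rw [← hk]
      refine ncard_lt_ncard ⟨inter_subset_inter_right _ (Ioo_subset_Ioo hc hd), fun h => ?_⟩ hfin
      have := (h ⟨hτS, hτ⟩).2
      rcases hcd with rfl | rfl
      · exact this.1.false
      · exact this.2.false
    have h1 := ih _ (hlt a τ le_rfl hτ.2.le (Or.inr rfl)) ha hτ.1 (hτ.2.le.trans hb) rfl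
    have h2 := ih _ (hlt τ b hτ.1.le le_rfl (Or.inl rfl)) (ha.trans hτ.1.le) hτ.2 hb rfl
    have h3 : (∫ t in a..τ, φ t) + ∫ t in τ..b, φ t = ∫ t in a..b, φ t := by
      refine intervalIntegral.integral_add_adjacent_intervals ?_ ?_
      · rw [intervalIntegrable_iff_integrableOn_Ioc_of_le hτ.1.le]
        exact φint.mono_set
          (Ioc_subset_Icc_self.trans (Icc_subset_Icc ha (hτ.2.le.trans hb)))
      · rw [intervalIntegrable_iff_integrableOn_Ioc_of_le hτ.2.le]
        exact φint.mono_set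
          (Ioc_subset_Icc_self.trans (Icc_subset_Icc (ha.trans hτ.1.le) hb))
    have h4 := finsum_mem_inter_Ioc_add hτ.1.le hτ.2.le
      (hS.subset (inter_subset_inter_right _ (Icc_subset_Icc ha hb))) w
    linarith

/-! ### Norms on `ℝⁿ` -/

theorem continuous_seminorm (p : Seminorm ℝ (State n)) : Continuous p :=
  continuousOn_univ.1 (p.convexOn.continuousOn isOpen_univ)

theorem IsNorm.exists_equiv {p : Seminorm ℝ (State n)} (hp : IsNorm p) :
    ∃ D > 0, ∀ x, ‖x‖ ≤ D * p x ∧ p x ≤ D * ‖x‖ := by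
  have hc := continuous_seminorm p
  obtain ⟨D₁, h₁, hD₁⟩ := Seminorm.bound_of_continuous_normedSpace p hc
  rcases subsingleton_or_nontrivial (State n) with hs | hs
  · exact ⟨1, one_pos, fun x => by simp [Subsingleton.elim x 0]⟩
  have hcomp := isCompact_sphere (0 : State n) 1
  obtain ⟨u, hu, hmin⟩ := hcomp.exists_isMinOn
    (NormedSpace.sphere_nonempty.2 zero_le_one) hc.continuousOn
  have hu1 : ‖u‖ = 1 := by simpa using hu
  have hpu : 0 < p u := by
    refine (apply_nonneg p u).lt_of_ne fun h => ?_
    rw [hp u h.symm, norm_zero] at hu1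
    exact zero_ne_one hu1
  refine ⟨max D₁ (p u)⁻¹, lt_max_of_lt_left h₁, fun x => ⟨?_, ?_⟩⟩
  · rcases eq_or_ne x 0 with rfl | hx
    · simp
    have hx' : 0 < ‖x‖ := norm_pos_iff.2 hx
    have h1 : p u ≤ p (‖x‖⁻¹ • x) := hmin (by
      simp [norm_smul, hx'.ne'])
    rw [map_smul_eq_mul, norm_inv, norm_norm] at h1
    have h2 : p u * ‖x‖ ≤ p x := by
      calc p u * ‖x‖ ≤ ‖x‖⁻¹ * p x * ‖x‖ := by gcongr
        _ = p x := by field_simp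
    calc ‖x‖ = (p u)⁻¹ * (p u * ‖x‖) := by field_simp
      _ ≤ (p u)⁻¹ * p x := by gcongr
      _ ≤ max D₁ (p u)⁻¹ * p x := by gcongr; exact le_max_right _ _
  · exact (hD₁ x).trans (by gcongr; exact le_max_left _ _)

theorem NormHyp.exists_equiv {N : ℝ → Seminorm ℝ (State n)} {S : Set ℝ} (hN : NormHyp N S) :
    ∃ D > 0, ∀ t, 0 ≤ t → ∀ x, ‖x‖ ≤ D * N t x ∧ N t x ≤ D * ‖x‖ := by
  obtain ⟨D, hD, h⟩ := (hN.isNorm 0 le_rfl).exists_equiv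
  obtain ⟨E, hE, h'⟩ := hN.equivalent
  refine ⟨D * E, by positivity, fun t ht x => ⟨?_, ?_⟩⟩
  · calc ‖x‖ ≤ D * N 0 x := (h x).1
      _ ≤ D * (E * N t x) := by gcongr; exact h' 0 le_rfl t ht x
      _ = D * E * N t x := by ring
  · calc N t x ≤ E * N 0 x := h' t ht 0 le_rfl x
      _ ≤ E * (D * ‖x‖) := by gcongr; exact (h x).2
      _ = D * E * ‖x‖ := by ring

theorem IsKappaReachable.euclidean {p : Seminorm ℝ (State n)} {D κ : ℝ} {C : Set (State n)}
    (hD : 0 < D) (hκ : 0 < κ) (hp : ∀ x, ‖x‖ ≤ D * p x ∧ p x ≤ D * ‖x‖)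
    (h : IsKappaReachable p κ C) :
    IsKappaReachable (normSeminorm ℝ (State n)) (D * κ * D) C := by
  intro x hx y hy
  obtain ⟨γ, h1, h2, h3, h4, h5⟩ := h x hx y hy
  refine ⟨γ, h1, h2, h3, h4, fun s hs => ?_⟩
  simp only [coe_normSeminorm]
  calc _ ≤ D * p (derivWithin γ (Icc 0 1) s) := (hp _).1
    _ ≤ D * (κ * (D * ‖x - y‖)) := by
        gcongr
        exact (h5 s hs).trans (by gcongr; exact (hp _).2)
    _ = _ := by ring

/-! ### The vector field near a trajectory -/

/-- One-sided limits bound `r` near each point, and compactness makes the bound global. At time `0`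
there is nothing on the left to control. -/
theorem IsPWC.exists_bound {r : ℝ → ℝ} (hr : IsPWC r) {a b : ℝ} (ha : 0 ≤ a) :
    ∃ R, ∀ t ∈ Icc a b, ‖r t‖ ≤ R := by
  refine isCompact_Icc.induction_on (p := fun s => ∃ R, ∀ t ∈ s, ‖r t‖ ≤ R) ⟨0, by simp⟩
    (fun s t hst ⟨R, hR⟩ => ⟨R, fun u hu => hR u (hst hu)⟩)
    (fun s t ⟨R, hR⟩ ⟨R', hR'⟩ => ⟨max R R', fun u hu => hu.elim
      (fun h => (hR u h).trans (le_max_left _ _)) (fun h => (hR' u h).trans (le_max_right _ _))⟩) ?_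
  intro t ht
  have h1 : ∀ᶠ u in 𝓝[>] t, ‖r u‖ ≤ ‖r t‖ + 1 :=
    ((hr.rightCont t (ha.trans ht.1)).norm.eventually_lt_const (lt_add_one _)).mono fun _ h => h.le
  have h2 : ∃ l, ∀ᶠ u in 𝓝[Icc a b] t, u < t → ‖r u‖ ≤ l := by
    rcases (ha.trans ht.1).eq_or_lt with h0 | h0
    · refine ⟨0, ?_⟩
      filter_upwards [self_mem_nhdsWithin] with u hu hut
      linarith [hu.1]
    · obtain ⟨l, hl⟩ := hr.leftLim t h0
      have := hl.norm.eventually_lt_const (lt_add_one _)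
      rw [eventually_nhdsWithin_iff] at this
      refine ⟨‖l‖ + 1, nhdsWithin_le_nhds ?_⟩
      filter_upwards [this] with u hu hut using (hu hut).le
  obtain ⟨l, hl⟩ := h2
  rw [eventually_nhdsWithin_iff] at h1
  refine ⟨_, Filter.Eventually.and (nhdsWithin_le_nhds h1) hl, max (‖r t‖ + 1) l, ?_⟩
  rintro u ⟨hu1, hu2⟩
  rcases lt_trichotomy u t with h | h | h
  · exact (hu2 h).trans (le_max_right _ _)
  · rw [h]; exact (lt_add_one _).le.trans (le_max_left _ _)
  · exact (hu1 h).trans (le_max_left _ _)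

/-- Only the base point `p` lies in the compact set; `q` ranges over all of `A`. This matters
because neighbours of a trajectory need not lie on it, and `C` need not be locally compact. -/
theorem exists_uniform_near_compact {X Y : Type*} [PseudoMetricSpace X] [PseudoMetricSpace Y]
    {F : X → Y} {A K : Set X} (hF : ContinuousOn F A) (hK : IsCompact K) (hKA : K ⊆ A) {η : ℝ}
    (hη : 0 < η) : ∃ ε > 0, ∀ p ∈ K, ∀ q ∈ A, dist p q < ε → dist (F p) (F q) < η := by
  have hK' : IsCompact ((↑) ⁻¹' K : Set A) := by
    rw [Topology.IsInducing.subtypeVal.isCompact_iff]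
    rwa [Subtype.image_preimage_coe, inter_eq_right.2 hKA]
  have := hK'.uniformContinuousAt_of_continuousAt (A.domRestrict F)
    (fun a _ => (continuousOn_iff_continuous_domRestrict.1 hF).continuousAt)
    (Metric.dist_mem_uniformity hη)
  obtain ⟨ε, hε, h⟩ := Metric.mem_uniformity_dist.1 this
  exact ⟨ε, hε, fun p hp q hq hpq => @h ⟨p, hKA hp⟩ ⟨q, hq⟩ hpq hp⟩

variable {C : Set (State n)} {f : State n → ℝ → State n}
  {J : State n → ℝ → (State n →L[ℝ] State n)} {r : ℝ → ℝ}

/-- Since `C` need not be convex, the mean value inequality is applied along the reachability curve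
from `x t` to `z`. The curve stays within `κ ‖z - x t‖` of `x t`; there the Jacobian varies by at
most `η / κ`, which times the speed `κ ‖z - x t‖` gives the error. -/
theorem FieldHyp.exists_linearization (hf : FieldHyp C f J r) {κ : ℝ} (hκ : 0 < κ)
    (hreach : IsKappaReachable (normSeminorm ℝ (State n)) κ C) {x : ℝ → State n} {a b R : ℝ}
    (hx : ContinuousOn x (Icc a b)) (hxC : ∀ t ∈ Icc a b, x t ∈ C)
    (hR : ∀ t ∈ Icc a b, ‖r t‖ ≤ R) {η : ℝ} (hη : 0 < η) :
    ∃ ε > 0, ∀ t ∈ Icc a b, ∀ z ∈ C, ‖z - x t‖ < ε →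
      ‖f z (r t) - f (x t) (r t) - J (x t) (r t) (z - x t)‖ ≤ η * ‖z - x t‖ := by
  set K : Set (State n × ℝ) := (x '' Icc a b) ×ˢ Icc (-R) R
  have hK : IsCompact K := (isCompact_Icc.image_of_continuousOn hx).prod isCompact_Icc
  have hKC : K ⊆ C ×ˢ univ := by
    rintro ⟨q, ρ⟩ ⟨⟨t, ht, rfl⟩, -⟩
    exact ⟨hxC t ht, mem_univ _⟩
  obtain ⟨ε, hε, h⟩ := exists_uniform_near_compact hf.contDeriv hK hKC (div_pos hη hκ)
  refine ⟨ε / κ, div_pos hε hκ, fun t ht z hz hzx => ?_⟩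
  obtain ⟨γ, hγ, hγC, h0, h1, hγ'⟩ := hreach (x t) (hxC t ht) z hz
  simp only [coe_normSeminorm] at hγ'
  rw [norm_sub_rev] at hγ'
  have hγd : ∀ s ∈ Icc (0 : ℝ) 1,
      HasDerivWithinAt γ (derivWithin γ (Icc 0 1) s) (Icc 0 1) s := fun s hs =>
    (hγ.differentiableOn one_ne_zero s hs).hasDerivWithinAt
  have hnear : ∀ s ∈ Icc (0 : ℝ) 1, ‖γ s - x t‖ < ε := fun s hs => by
    have := norm_image_sub_le_of_norm_deriv_le_segment' hγd
      (fun s hs => hγ' s (Ico_subset_Icc_self hs)) s hs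
    rw [h0] at this
    calc _ ≤ κ * ‖z - x t‖ * (s - 0) := this
      _ ≤ κ * ‖z - x t‖ * 1 := by
          gcongr
          linarith [hs.2]
      _ < κ * (ε / κ) := by rw [mul_one]; gcongr
      _ = ε := by field_simp
  have hd : ∀ s ∈ Icc (0 : ℝ) 1,
      HasDerivWithinAt (fun s => f (γ s) (r t) - J (x t) (r t) (γ s))
        ((J (γ s) (r t) - J (x t) (r t)) (derivWithin γ (Icc 0 1) s)) (Icc 0 1) s := fun s hs =>
    ((hf.hasDeriv (γ s) (hγC hs) (r t)).comp_hasDerivWithinAt s (hγd s hs) hγC).sub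
      ((J (x t) (r t)).hasFDerivAt.comp_hasDerivWithinAt s (hγd s hs))
  have key := norm_image_sub_le_of_norm_deriv_le_segment_01' hd (C := η * ‖z - x t‖) fun s hs => by
    have hs := Ico_subset_Icc_self hs
    have hJ : ‖J (γ s) (r t) - J (x t) (r t)‖ ≤ η / κ := by
      have := h (x t, r t) ⟨mem_image_of_mem x ht, abs_le.1 (hR t ht)⟩ (γ s, r t)
        ⟨hγC hs, mem_univ _⟩ (by
          rw [Prod.dist_eq, dist_self, dist_comm, dist_eq_norm]
          exact max_lt (hnear s hs) hε)
      rw [dist_comm, dist_eq_norm] at this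
      exact this.le
    calc _ ≤ ‖J (γ s) (r t) - J (x t) (r t)‖ * ‖derivWithin γ (Icc 0 1) s‖ :=
          ContinuousLinearMap.le_opNorm _ _
      _ ≤ η / κ * (κ * ‖z - x t‖) := by gcongr; exact hγ' s hs
      _ = η * ‖z - x t‖ := by field_simp
  rw [h0, h1] at key
  have hrw : f z (r t) - f (x t) (r t) - J (x t) (r t) (z - x t) =
      f z (r t) - J (x t) (r t) z - (f (x t) (r t) - J (x t) (r t) (x t)) := by
    rw [map_sub]
    abel
  rwa [hrw]

theorem FieldHyp.exists_jacobian_bound (hf : FieldHyp C f J r) {x : ℝ → State n} {a b R : ℝ}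
    (hx : ContinuousOn x (Icc a b)) (hxC : ∀ t ∈ Icc a b, x t ∈ C)
    (hR : ∀ t ∈ Icc a b, ‖r t‖ ≤ R) : ∃ L ≥ 0, ∀ t ∈ Icc a b, ‖J (x t) (r t)‖ ≤ L := by
  have hK : IsCompact ((x '' Icc a b) ×ˢ Icc (-R) R) :=
    (isCompact_Icc.image_of_continuousOn hx).prod isCompact_Icc
  obtain ⟨L, hL⟩ := hK.exists_bound_of_continuousOn (hf.contDeriv.mono (by
    rintro ⟨q, ρ⟩ ⟨⟨t, ht, rfl⟩, -⟩
    exact ⟨hxC t ht, mem_univ _⟩))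
  exact ⟨max L 0, le_max_right _ _, fun t ht =>
    (hL (x t, r t) ⟨mem_image_of_mem x ht, abs_le.1 (hR t ht)⟩).trans (le_max_left _ _)⟩

/-! ### Solutions -/

theorem IsSolution.continuousOn {t₀ : ℝ} {x : ℝ → State n} (hx : IsSolution C f r t₀ x) :
    ContinuousOn x (Ici t₀) := by
  intro t ht
  have ht' : t₀ ≤ t + 1 := (mem_Ici.1 ht).trans (lt_add_one t).le
  have h1 : ContinuousOn (fun u => x t₀ + ∫ s in t₀..u, f (x s) (r s)) (Icc t₀ (t + 1)) := by
    have := hx.integrable (t + 1) ht'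
    rw [intervalIntegrable_iff_integrableOn_Icc_of_le ht', ← uIcc_of_le ht'] at this
    rw [← uIcc_of_le ht']
    exact continuousOn_const.add (intervalIntegral.continuousOn_primitive_interval this)
  have h2 : ContinuousOn x (Icc t₀ (t + 1)) := h1.congr fun u hu => hx.eq u hu.1
  refine (h2 t ⟨ht, (lt_add_one t).le⟩).mono_of_mem_nhdsWithin ?_
  rw [← Ici_inter_Iic]
  exact inter_mem self_mem_nhdsWithin (nhdsWithin_le_nhds (Iic_mem_nhds (lt_add_one t)))

/-- Right-continuity of `r` makes the integrand right-continuous, so the right derivative exists at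
every time, including discontinuities of `r`. -/
theorem IsSolution.hasDerivWithinAt (hr : IsPWC r) (hf : FieldHyp C f J r) {t₀ : ℝ} (h₀ : 0 ≤ t₀)
    {x : ℝ → State n} (hx : IsSolution C f r t₀ x) {t : ℝ} (ht : t₀ ≤ t) :
    HasDerivWithinAt x (f (x t) (r t)) (Ici t) t := by
  have ht' : t₀ ≤ t + 1 := ht.trans (lt_add_one t).le
  have hxt : Tendsto x (𝓝[>] t) (𝓝 (x t)) :=
    (hx.continuousOn t ht).mono_left (nhdsWithin_mono _ fun u hu => ht.trans (le_of_lt hu))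
  have hc : ContinuousWithinAt (fun s => f (x s) (r s)) (Ioi t) t := by
    refine (hf.cont (x t, r t) ⟨hx.mem t ht, mem_univ _⟩).tendsto.comp
      (tendsto_nhdsWithin_iff.2 ⟨hxt.prodMk_nhds (hr.rightCont t (h₀.trans ht)), ?_⟩)
    filter_upwards [self_mem_nhdsWithin] with u hu
    exact ⟨hx.mem u (ht.trans (le_of_lt hu)), mem_univ _⟩
  have hmeas : StronglyMeasurableAtFilter (fun s => f (x s) (r s)) (𝓝[>] t) := by
    refine ⟨Ioc t (t + 1), Ioc_mem_nhdsGT (lt_add_one t), ?_⟩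
    have := (hx.integrable (t + 1) ht')
    rw [intervalIntegrable_iff_integrableOn_Ioc_of_le ht'] at this
    exact (this.mono_set (Ioc_subset_Ioc_left ht)).aestronglyMeasurable
  have h1 := intervalIntegral.integral_hasDerivWithinAt_right (hx.integrable t ht)
    (s := Ici t) (t := Ioi t) hmeas hc
  refine (h1.const_add (x t₀)).congr (fun u hu => hx.eq u (ht.trans hu)) (hx.eq t ht)

/-- A Grönwall estimate that needs the Lipschitz condition only close to zero. -/
theorem norm_le_exp_of_norm_deriv_le_near_zero {w w' : ℝ → State n} {a b L ε δ : ℝ}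
    (hw : ContinuousOn w (Icc a b)) (hw' : ∀ t ∈ Ico a b, HasDerivWithinAt w (w' t) (Ici t) t)
    (hL : 0 ≤ L) (hbound : ∀ t ∈ Ico a b, ‖w t‖ < ε → ‖w' t‖ ≤ L * ‖w t‖) (hδ : 0 < δ)
    (ha : ‖w a‖ ≤ δ) (hδε : δ * Real.exp ((L + 1) * (b - a)) < ε) {t : ℝ} (ht : t ∈ Icc a b) :
    ‖w t‖ ≤ δ * Real.exp ((L + 1) * (t - a)) := by
  have hB : ∀ t, HasDerivAt (fun t => δ * Real.exp ((L + 1) * (t - a)))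
      (δ * (Real.exp ((L + 1) * (t - a)) * ((L + 1) * 1))) t := fun t =>
    (((((hasDerivAt_id t).sub_const a).const_mul (L + 1)).exp).const_mul δ)
  -- The barrier grows at rate `L + 1` rather than `L` to get a strict inequality at a contact
  -- point, and `hδε` keeps it below `ε`, where the Lipschitz bound is available.
  refine image_norm_le_of_norm_deriv_right_lt_deriv_boundary hw hw' (by simpa using ha) hB
    (fun t ht hBt => ?_) ht
  have hpos : 0 < δ * Real.exp ((L + 1) * (t - a)) := by positivity
  have hlt : ‖w t‖ < ε := by
    refine lt_of_le_of_lt ?_ hδε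
    rw [hBt]
    gcongr
    exact ht.2.le
  have := hbound t ht hlt
  rw [hBt] at this
  nlinarith

/-- The Grönwall estimate holds for every small `δ`. By contraposition, a difference of solutions
that is nonzero at the final time never vanished before, so its logarithm may be used. -/
theorem eq_zero_of_norm_deriv_le_near_zero {w w' : ℝ → State n} {a b L ε : ℝ}
    (hw : ContinuousOn w (Icc a b)) (hw' : ∀ t ∈ Ico a b, HasDerivWithinAt w (w' t) (Ici t) t)
    (hL : 0 ≤ L) (hε : 0 < ε) (hbound : ∀ t ∈ Ico a b, ‖w t‖ < ε → ‖w' t‖ ≤ L * ‖w t‖)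
    (ha : w a = 0) (hab : a ≤ b) : w b = 0 := by
  set E := Real.exp ((L + 1) * (b - a))
  have hE : 0 < E := Real.exp_pos _
  rw [← norm_le_zero_iff]
  refine le_of_forall_gt_imp_ge_of_dense fun e he => ?_
  have hm : 0 < min e (ε / 2) := lt_min he (half_pos hε)
  have h1 : min e (ε / 2) / E * E = min e (ε / 2) := by field_simp
  have := norm_le_exp_of_norm_deriv_le_near_zero hw hw' hL hbound (div_pos hm hE)
    (by rw [ha, norm_zero]; positivity)
    (by
      change min e (ε / 2) / E * E < ε
      rw [h1]
      exact (min_le_right _ _).trans_lt (half_lt_self hε)) (right_mem_Icc.2 hab)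
  change ‖w b‖ ≤ min e (ε / 2) / E * E at this
  rw [h1] at this
  exact this.trans (min_le_left _ _)

/-! ### Growth of the switched norm along a curve -/

/-- The supremum over the unit sphere of `N t` extends to all vectors by homogeneity. -/
theorem eventually_norm_add_le {N : ℝ → Seminorm ℝ (State n)} {t a y : ℝ}
    {A : State n →L[ℝ] State n} (hN : IsNorm (N t)) (hA : switchedMeasure N t A ≤ (a : EReal))
    (hy : a < y) :
    ∀ᶠ h in 𝓝[>] (0 : ℝ), ∀ x, N (t + h) (x + h • A x) ≤ (1 + h * y) * N t x := by
  have h1 : switchedMeasure N t A < (y : EReal) := hA.trans_lt (EReal.coe_lt_coe_iff.2 hy)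
  filter_upwards [eventually_lt_of_limsup_lt h1, self_mem_nhdsWithin] with h hh hpos x
  have hpos : 0 < h := hpos
  rcases eq_or_ne x 0 with rfl | hx
  · simp
  have hx' : 0 < N t x := (apply_nonneg _ _).lt_of_ne fun h => hx (hN x h.symm)
  set u := (N t x)⁻¹ • x with hu
  have hu1 : N t u = 1 := by
    rw [hu, map_smul_eq_mul, norm_inv, Real.norm_of_nonneg hx'.le, inv_mul_cancel₀ hx'.ne']
  have hxu : x = N t x • u := by rw [hu, smul_inv_smul₀ hx'.ne']
  have h2 : (((N (t + h) (u + h • A u) - 1) / h : ℝ) : EReal) < (y : EReal) :=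
    (le_iSup₂ (f := fun (x : State n) (_ : x ∈ {x : State n | N t x = 1}) =>
      (((N (t + h) (x + h • A x) - 1) / h : ℝ) : EReal)) u hu1).trans_lt hh
  have h3 : N (t + h) (u + h • A u) ≤ 1 + h * y := by
    have := (div_lt_iff₀ hpos).1 (EReal.coe_lt_coe_iff.1 h2)
    linarith
  have h4 : x + h • A x = N t x • (u + h • A u) := by
    conv_lhs => rw [hxu, map_smul, smul_comm h, ← smul_add]
  rw [h4, map_smul_eq_mul, Real.norm_of_nonneg hx'.le, mul_comm]
  gcongr

/-- Split `w u` into the Euler step `w t + (u - t) A (w t)`, controlled by the matrix measure, the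
linearization error, which costs `D * D * η` after two changes of norm, and the differentiability
remainder. Then `log (1 + s) ≤ s`. -/
theorem log_norm_dini_le {N : ℝ → Seminorm ℝ (State n)} {t a y D η : ℝ}
    {A : State n →L[ℝ] State n} {w : ℝ → State n} {w' : State n} (ht : 0 ≤ t) (hD : 0 < D)
    (hND : ∀ t, 0 ≤ t → ∀ x, ‖x‖ ≤ D * N t x ∧ N t x ≤ D * ‖x‖)
    (hN : IsNorm (N t)) (hA : switchedMeasure N t A ≤ (a : EReal))
    (hw : HasDerivWithinAt w w' (Ici t) t) (hw0 : w t ≠ 0)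
    (hw' : ‖w' - A (w t)‖ ≤ η * ‖w t‖) (hη : 0 ≤ η) (hy : a + D * D * η < y) :
    ∀ᶠ u in 𝓝[>] t, Real.log (N u (w u)) - Real.log (N t (w t)) ≤ (u - t) * y := by
  -- Half of the slack goes to the limsup in the matrix measure, half to the differentiability
  -- remainder.
  obtain ⟨μ, hμ⟩ : ∃ μ, μ = (y - a - D * D * η) / 2 := ⟨_, rfl⟩
  have hμ0 : 0 < μ := by rw [hμ]; linarith
  set g := N t (w t)
  have hg : 0 < g := (apply_nonneg _ _).lt_of_ne fun h => hw0 (hN _ h.symm)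
  have h1 : ∀ᶠ u in 𝓝[>] t, ∀ x, N u (x + (u - t) • A x) ≤ (1 + (u - t) * (a + μ)) * N t x := by
    have hm : Tendsto (fun u => u - t) (𝓝[>] t) (𝓝[>] 0) := by
      refine tendsto_nhdsWithin_iff.2 ⟨?_, ?_⟩
      · have : Tendsto (fun u => u - t) (𝓝 t) (𝓝 (t - t)) :=
          (continuous_id.sub continuous_const).tendsto t
        rw [sub_self] at this
        exact this.mono_left nhdsWithin_le_nhds
      · filter_upwards [self_mem_nhdsWithin] with u hu using sub_pos.2 (mem_Ioi.1 hu)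
    filter_upwards [hm.eventually (eventually_norm_add_le hN hA (lt_add_of_pos_right a hμ0))]
      with u hu x
    simpa using hu x
  have h2 : ∀ᶠ u in 𝓝[>] t, ‖w u - w t - (u - t) • w'‖ ≤ μ * g / D * ‖u - t‖ :=
    (hw.mono Ioi_subset_Ici_self).isLittleO.bound (by positivity)
  have h3 : ∀ᶠ u in 𝓝[>] t, w u ≠ 0 :=
    (hw.mono Ioi_subset_Ici_self).continuousWithinAt.eventually_ne hw0
  filter_upwards [h1, h2, h3, self_mem_nhdsWithin] with u hu1 hu2 hu3 hut
  have hh : 0 < u - t := sub_pos.2 hut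
  have hu0 : 0 ≤ u := ht.trans (le_of_lt hut)
  rw [Real.norm_of_nonneg hh.le] at hu2
  have hgu : 0 < N u (w u) := by
    have := (hND u hu0 (w u)).1
    have h4 := norm_pos_iff.2 hu3
    by_contra hcon
    have : D * N u (w u) ≤ 0 := mul_nonpos_of_nonneg_of_nonpos hD.le (not_lt.1 hcon)
    linarith
  have hle : N u (w u) ≤ (1 + (u - t) * y) * g := by
    have hdec : w u = (w t + (u - t) • A (w t)) +
        ((u - t) • (w' - A (w t)) + (w u - w t - (u - t) • w')) := by
      rw [smul_sub]
      abel
    calc N u (w u) ≤ N u (w t + (u - t) • A (w t)) +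
          N u ((u - t) • (w' - A (w t)) + (w u - w t - (u - t) • w')) := by
            conv_lhs => rw [hdec]
            exact map_add_le_add _ _ _
      _ ≤ (1 + (u - t) * (a + μ)) * g + D * ((u - t) * (η * (D * g)) + μ * g / D * (u - t)) := by
            refine add_le_add (hu1 _) (((hND u hu0 _).2).trans ?_)
            gcongr
            refine (norm_add_le _ _).trans (add_le_add ?_ hu2)
            rw [norm_smul, Real.norm_of_nonneg hh.le]
            gcongr
            exact hw'.trans (by gcongr; exact (hND t ht _).1)
      _ = (1 + (u - t) * y) * g := by
            rw [hμ]
            field_simp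
            ring
  have hpos : 0 < 1 + (u - t) * y := by
    by_contra hcon
    have := mul_nonpos_of_nonpos_of_nonneg (not_lt.1 hcon) hg.le
    linarith
  have h5 := Real.log_le_log hgu hle
  rw [Real.log_mul hpos.ne' hg.ne'] at h5
  have h6 := Real.log_le_sub_one_of_pos hpos
  linarith

/-- All the norms are Lipschitz with the same constant `D`, so convergence at the fixed vector `v`
passes to vectors tending to `v`. -/
theorem tendsto_norm_along {N : ℝ → Seminorm ℝ (State n)} {D l : ℝ} {F : Filter ℝ}
    {w : ℝ → State n} {v : State n} (hND : ∀ t, 0 ≤ t → ∀ x, N t x ≤ D * ‖x‖)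
    (hF : ∀ᶠ s in F, 0 ≤ s) (hN : Tendsto (fun s => N s v) F (𝓝 l)) (hw : Tendsto w F (𝓝 v)) :
    Tendsto (fun s => N s (w s)) F (𝓝 l) := by
  have h0 : Tendsto (fun s => D * ‖w s - v‖) F (𝓝 0) := by
    have : Tendsto (fun s => D * ‖w s - v‖) F (𝓝 (D * ‖v - v‖)) :=
      ((hw.sub_const v).norm).const_mul D
    simpa using this
  have h1 : Tendsto (fun s => N s (w s) - N s v) F (𝓝 0) := by
    refine squeeze_zero_norm' ?_ h0
    filter_upwards [hF] with s hs
    exact (abs_sub_map_le_sub (N s) (w s) v).trans (hND s hs _)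
  simpa using h1.add hN

/-! ### Contraction of nearby solutions -/

/-- The hypotheses on the system, with reachability in the Euclidean norm. -/
structure ContractionHyp (C : Set (State n)) (f : State n → ℝ → State n)
    (J : State n → ℝ → (State n →L[ℝ] State n)) (r : ℝ → ℝ) (N : ℝ → Seminorm ℝ (State n))
    (S : Set ℝ) (α β : ℝ → ℝ) (κ : ℝ) : Prop where
  signal : IsPWC r
  field : FieldHyp C f J r
  norms : NormHyp N S
  kappa_pos : 0 < κ
  reach : IsKappaReachable (normSeminorm ℝ (State n)) κ C
  integrable : LocallyIntegrableOn α (Ici 0) volume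
  measure_le : ∀ t, 0 ≤ t → t ∉ S → ∀ x ∈ C, switchedMeasure N t (J x (r t)) ≤ (α t : EReal)
  jump_nonneg : ∀ τ ∈ S, 0 ≤ β τ
  jump_le : ∀ τ ∈ S, 0 < τ → ∀ x, N τ x ≤ β τ * leftNorm N τ x

variable {N : ℝ → Seminorm ℝ (State n)} {S : Set ℝ} {α β : ℝ → ℝ} {κ : ℝ}

theorem accumulated_zero (α β : ℝ → ℝ) (S : Set ℝ) (t : ℝ) : accumulated α β S t 0 = 0 := by
  simp [accumulated]

/-- A jump of the logarithm of the switched norm along a curve. -/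
theorem ContractionHyp.exists_left_limit_log (h : ContractionHyp C f J r N S α β κ) {D : ℝ}
    (hD : 0 < D) (hND : ∀ t, 0 ≤ t → ∀ x, ‖x‖ ≤ D * N t x ∧ N t x ≤ D * ‖x‖)
    {w : ℝ → State n} {t : ℝ} (ht : 0 < t) (hw : Tendsto w (𝓝[<] t) (𝓝 (w t))) (hw0 : w t ≠ 0) :
    ∃ l, Tendsto (fun s => Real.log (N s (w s))) (𝓝[<] t) (𝓝 l) ∧
      (t ∉ S → l = Real.log (N t (w t))) ∧
      (t ∈ S → Real.log (N t (w t)) ≤ l + Real.log (β t)) := by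
  have hev : ∀ᶠ s in 𝓝[<] t, 0 ≤ s := by
    filter_upwards [Ioo_mem_nhdsLT ht] with s hs using hs.1.le
  have hpos : 0 < N t (w t) :=
    (apply_nonneg _ _).lt_of_ne fun h' => hw0 (h.norms.isNorm t ht.le _ h'.symm)
  by_cases htS : t ∈ S
  · obtain ⟨l, hl⟩ := h.norms.leftLim t ht htS (w t)
    have hlpos : 0 < l := by
      have h1 : ‖w t‖ / D ≤ l := ge_of_tendsto hl <| by
        filter_upwards [hev] with s hs
        rw [div_le_iff₀' hD]
        exact (hND s hs _).1
      exact (div_pos (norm_pos_iff.2 hw0) hD).trans_le h1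
    have hleft : leftNorm N t (w t) = l := leftLim_eq_of_tendsto hl
    have hj := h.jump_le t htS ht (w t)
    rw [hleft] at hj
    -- A zero factor would force `N t (w t) = 0`. Hence the convention `Real.log 0 = 0` plays no
    -- role here.
    have hβ : 0 < β t := by
      refine (h.jump_nonneg t htS).lt_of_ne fun h0 => ?_
      rw [← h0, zero_mul] at hj
      linarith
    refine ⟨Real.log l, (tendsto_norm_along (fun t ht x => (hND t ht x).2) hev hl hw).log
      hlpos.ne', fun h' => absurd htS h', fun _ => ?_⟩
    have := Real.log_le_log hpos hj
    rw [Real.log_mul hβ.ne' hlpos.ne'] at this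
    linarith
  · exact ⟨_, (tendsto_norm_along (fun t ht x => (hND t ht x).2) hev
      (h.norms.leftCont t ht htS (w t)) hw).log hpos.ne', fun _ => rfl, fun h' => absurd h' htS⟩

/-- The radius `δ` may depend on `x`, `t₁` and `η`; the contraction factor does not depend on `x`.
The time `t₁` is kept off `S` because `accumulated` omits a jump at the right end. -/
theorem ContractionHyp.exists_local_contraction (h : ContractionHyp C f J r N S α β κ) {t₀ t₁ : ℝ}
    (h₀ : 0 ≤ t₀) (h₁ : t₀ ≤ t₁) (ht₁ : t₁ ∉ S) {x : ℝ → State n} (hx : IsSolution C f r t₀ x)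
    {η : ℝ} (hη : 0 < η) :
    ∃ δ > 0, ∀ z, IsSolution C f r t₀ z → ‖z t₀ - x t₀‖ < δ →
      N t₁ (z t₁ - x t₁) ≤
        Real.exp (accumulated α β S t₀ (t₁ - t₀) + η * (t₁ - t₀)) * N t₀ (z t₀ - x t₀) := by
  rcases h₁.eq_or_lt with rfl | h₁'
  · exact ⟨1, one_pos, fun z _ _ => by simp [accumulated_zero]⟩
  obtain ⟨D, hD, hND⟩ := h.norms.exists_equiv
  obtain ⟨R, hR⟩ := h.signal.exists_bound (b := t₁) h₀
  have hxc : ContinuousOn x (Icc t₀ t₁) := hx.continuousOn.mono Icc_subset_Ici_self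
  have hxC : ∀ t ∈ Icc t₀ t₁, x t ∈ C := fun t ht => hx.mem t ht.1
  -- Chosen so that the loss `D * D * θ` in `log_norm_dini_le` is exactly `η`.
  set θ := η / (D * D) with hθ
  have hθ0 : 0 < θ := by positivity
  obtain ⟨ε, hε, hlin⟩ := h.field.exists_linearization h.kappa_pos h.reach hxc hxC hR hθ0
  obtain ⟨L, hL, hJ⟩ := h.field.exists_jacobian_bound hxc hxC hR
  -- The largest growth allowed by the Grönwall estimate up to `t₁`: starting within `ε / (2 * E)`
  -- keeps `z` in the tube where the linearization holds.
  set E := Real.exp ((L + θ + 1) * (t₁ - t₀)) with hE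
  have hE0 : 0 < E := Real.exp_pos _
  refine ⟨ε / (2 * E), by positivity, fun z hz hzx => ?_⟩
  set w : ℝ → State n := fun t => z t - x t with hw
  have hwc : ContinuousOn w (Icc t₀ t₁) :=
    (hz.continuousOn.mono Icc_subset_Ici_self).sub hxc
  have hwd : ∀ t, t₀ ≤ t → HasDerivWithinAt w (f (z t) (r t) - f (x t) (r t)) (Ici t) t :=
    fun t ht => (hz.hasDerivWithinAt h.signal h.field h₀ ht).sub
      (hx.hasDerivWithinAt h.signal h.field h₀ ht)
  have hlip : ∀ t ∈ Icc t₀ t₁, ‖w t‖ < ε →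
      ‖f (z t) (r t) - f (x t) (r t)‖ ≤ (L + θ) * ‖w t‖ := fun t ht hwt => by
    have h1 := hlin t ht (z t) (hz.mem t ht.1) hwt
    have h2 : ‖J (x t) (r t) (w t)‖ ≤ L * ‖w t‖ :=
      (ContinuousLinearMap.le_opNorm _ _).trans (by gcongr; exact hJ t ht)
    have h3 := norm_add_le (f (z t) (r t) - f (x t) (r t) - J (x t) (r t) (w t))
      (J (x t) (r t) (w t))
    rw [sub_add_cancel] at h3
    linarith
  have hδE : ε / (2 * E) * E < ε := by
    have : ε / (2 * E) * E = ε / 2 := by field_simp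
    rw [this]
    exact half_lt_self hε
  have hnear : ∀ t ∈ Icc t₀ t₁, ‖w t‖ < ε := fun t ht => by
    refine (norm_le_exp_of_norm_deriv_le_near_zero hwc (fun t ht => hwd t ht.1) (by positivity)
      (fun t ht => hlip t (Ico_subset_Icc_self ht)) (by positivity) hzx.le hδE ht).trans_lt
      (lt_of_le_of_lt ?_ hδE)
    rw [hE]
    gcongr
    exact ht.2
  by_cases hw1 : w t₁ = 0
  · change N t₁ (w t₁) ≤ _
    rw [hw1, map_zero]
    positivity
  have hne : ∀ t ∈ Icc t₀ t₁, w t ≠ 0 := fun t ht hwt =>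
    hw1 (eq_zero_of_norm_deriv_le_near_zero (hwc.mono (Icc_subset_Icc_left ht.1))
      (fun s hs => hwd s (ht.1.trans hs.1)) (add_nonneg hL hθ0.le) hε
      (fun s hs => hlip s ⟨ht.1.trans hs.1, hs.2.le⟩) hwt ht.2)
  have hpos : ∀ t ∈ Icc t₀ t₁, 0 < N t (w t) := fun t ht =>
    (apply_nonneg _ _).lt_of_ne fun h' => hne t ht (h.norms.isNorm t (h₀.trans ht.1) _ h'.symm)
  have hαint : IntegrableOn α (Icc t₀ t₁) :=
    h.integrable.integrableOn_compact_subset (fun t ht => h₀.trans ht.1) isCompact_Icc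
  have hαi : IntervalIntegrable α volume t₀ t₁ :=
    (intervalIntegrable_iff_integrableOn_Icc_of_le h₁).2 hαint
  have key := sub_le_integral_add_jumps (g := fun t => Real.log (N t (w t)))
    (φ := fun t => α t + η) (w := fun t => Real.log (β t)) (S := S) (A := t₀) (B := t₁)
    ((h.norms.jumps t₁).subset (inter_subset_inter_right _ (Icc_subset_Icc_left h₀)))
    (fun t ht => (tendsto_norm_along (fun t ht x => (hND t ht x).2)
      (by filter_upwards [self_mem_nhdsWithin] with s hs using
        (h₀.trans ht.1).trans (le_of_lt hs))
      (h.norms.rightCont t (h₀.trans ht.1) (w t))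
      ((hwd t ht.1).continuousWithinAt.mono Ioi_subset_Ici_self)).log
        (hpos t (Ico_subset_Icc_self ht)).ne')
    (fun t ht => h.exists_left_limit_log hD hND (h₀.trans_lt ht.1)
      ((hwc t (Ioc_subset_Icc_self ht)).mono_of_mem_nhdsWithin
        (mem_of_superset (Ioo_mem_nhdsLT ht.1) fun s hs => ⟨hs.1.le, hs.2.le.trans ht.2⟩))
      (hne t (Ioc_subset_Icc_self ht)))
    (fun t ht htS y hy => by
      have ht' := Ioo_subset_Icc_self ht
      have ht0 := h₀.trans ht'.1
      refine log_norm_dini_le ht0 hD hND (h.norms.isNorm t ht0)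
        (h.measure_le t ht0 htS (x t) (hxC t ht')) (hwd t ht'.1) (hne t ht')
        (hlin t ht' (z t) (hz.mem t ht'.1) (hnear t ht')) hθ0.le ?_
      have : D * D * θ = η := by rw [hθ]; field_simp
      rw [this]
      exact hy)
    (hαint.add (by simp)) le_rfl h₁' le_rfl
  have hsum : S ∩ Ioc t₀ t₁ = S ∩ Ioo t₀ t₁ := by
    ext t
    refine ⟨fun ht => ⟨ht.1, ht.2.1, ht.2.2.lt_of_ne ?_⟩, fun ht => ⟨ht.1, ht.2.1, ht.2.2.le⟩⟩
    rintro rfl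
    exact ht₁ ht.1
  have hint : ∫ t in t₀..t₁, (α t + η) = (∫ t in t₀..t₁, α t) + η * (t₁ - t₀) := by
    rw [intervalIntegral.integral_add hαi (by simp)]
    simp [mul_comm]
  rw [hsum, hint] at key
  have hacc : accumulated α β S t₀ (t₁ - t₀) =
      (∫ t in t₀..t₁, α t) + ∑ᶠ τ ∈ S ∩ Ioo t₀ t₁, Real.log (β τ) := by
    rw [accumulated, add_sub_cancel]
  change N t₁ (w t₁) ≤ _ * N t₀ (w t₀)
  have hl : Real.log (N t₁ (w t₁)) ≤
      accumulated α β S t₀ (t₁ - t₀) + η * (t₁ - t₀) + Real.log (N t₀ (w t₀)) := by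
    rw [hacc]
    linarith
  calc N t₁ (w t₁) = Real.exp (Real.log (N t₁ (w t₁))) :=
        (Real.exp_log (hpos t₁ (right_mem_Icc.2 h₁))).symm
    _ ≤ Real.exp (accumulated α β S t₀ (t₁ - t₀) + η * (t₁ - t₀) + Real.log (N t₀ (w t₀))) := by
        gcongr
    _ = _ := by rw [Real.exp_add, Real.exp_log (hpos t₀ (left_mem_Icc.2 h₁))]

/-! ### Contraction of arbitrary pairs of solutions -/

/-- The neighbourhood may depend on `s`. The hypothesis itself gives continuity and bounds the right
slopes of `‖F s - F a‖` by `L`, which is enough for a comparison with `L * (s - a)`. -/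
theorem norm_sub_le_of_eventually_norm_sub_le {E : Type*} [NormedAddCommGroup E] {F : ℝ → E}
    {a b L : ℝ} (hab : a ≤ b)
    (hF : ∀ s ∈ Icc a b, ∀ᶠ u in 𝓝[Icc a b] s, ‖F u - F s‖ ≤ L * ‖u - s‖) :
    ‖F b - F a‖ ≤ L * (b - a) := by
  have hc : ContinuousOn F (Icc a b) := fun s hs => by
    rw [ContinuousWithinAt, tendsto_iff_norm_sub_tendsto_zero]
    refine squeeze_zero' (Eventually.of_forall fun _ => norm_nonneg _) (hF s hs) ?_
    have : Tendsto (fun u => L * ‖u - s‖) (𝓝 s) (𝓝 (L * ‖s - s‖)) :=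
      ((continuous_id.sub continuous_const).norm.const_mul L).tendsto s
    rw [sub_self, norm_zero, mul_zero] at this
    exact this.mono_left nhdsWithin_le_nhds
  refine image_le_of_liminf_slope_right_le_deriv_boundary (f := fun s => ‖F s - F a‖)
    (B := fun s => L * (s - a)) (B' := fun _ => L) (hc.sub continuousOn_const).norm (by simp)
    (by fun_prop) (fun s _ => by
      simpa using (((hasDerivAt_id s).sub_const a).const_mul L).hasDerivWithinAt) ?_
    (right_mem_Icc.2 hab)
  intro s hs ρ hρ
  refine Eventually.frequently ?_
  have h1 := (hF s (Ico_subset_Icc_self hs)).filter_mono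
    (le_inf inf_le_left (le_principal_iff.2 (mem_of_superset (Ioc_mem_nhdsGT hs.2) fun u hu =>
      ⟨hs.1.trans hu.1.le, hu.2⟩)) : 𝓝[>] s ≤ 𝓝[Icc a b] s)
  filter_upwards [h1, self_mem_nhdsWithin] with u hu hsu
  have hsu : 0 < u - s := sub_pos.2 hsu
  rw [slope_def_field, div_lt_iff₀ hsu]
  rw [Real.norm_of_nonneg hsu.le] at hu
  have h2 := norm_sub_norm_le (F u - F a) (F s - F a)
  rw [sub_sub_sub_cancel_right] at h2
  have h3 : L * (u - s) < ρ * (u - s) := by gcongr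
  linarith

theorem ContractionHyp.exists_contraction (h : ContractionHyp C f J r N S α β κ)
    (hinv : ForwardInvariant C f r) :
    ∃ K > 0, ∀ t₀ ≥ 0, ∀ t₁ ≥ t₀, t₁ ∉ S → ∀ x y, IsSolution C f r t₀ x → IsSolution C f r t₀ y →
      ‖x t₁ - y t₁‖ ≤ K * Real.exp (accumulated α β S t₀ (t₁ - t₀)) * ‖x t₀ - y t₀‖ := by
  obtain ⟨D, hD, hND⟩ := h.norms.exists_equiv
  have hκ := h.kappa_pos
  refine ⟨D * D * Real.exp 1 * κ, by positivity, fun t₀ h₀ t₁ h₁ ht₁ x y hx hy => ?_⟩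
  obtain ⟨γ, hγ, hγC, hγ0, hγ1, hγ'⟩ := h.reach (x t₀) (hx.mem t₀ le_rfl) (y t₀) (hy.mem t₀ le_rfl)
  simp only [coe_normSeminorm] at hγ'
  set M := D * D * Real.exp (accumulated α β S t₀ (t₁ - t₀) + 1) with hM
  set G := κ * ‖x t₀ - y t₀‖ with hG
  have hγlip : ∀ s ∈ Icc (0 : ℝ) 1, ∀ u ∈ Icc (0 : ℝ) 1, ‖γ u - γ s‖ ≤ G * ‖u - s‖ :=
    fun s hs u hu => (convex_Icc (0 : ℝ) 1).norm_image_sub_le_of_norm_derivWithin_le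
      (hγ.differentiableOn one_ne_zero) hγ' hs hu
  -- The given solutions are prescribed at the two ends of the curve; in between any solution will
  -- do, so uniqueness is not invoked.
  have hsol : ∀ s : ℝ, ∃ X : ℝ → State n,
      (s ∈ Icc (0 : ℝ) 1 → IsSolution C f r t₀ X ∧ X t₀ = γ s) ∧ (s = 0 → X = x) ∧
        (s = 1 → X = y) := by
    intro s
    by_cases hs0 : s = 0
    · subst hs0
      exact ⟨x, fun _ => ⟨hx, hγ0.symm⟩, fun _ => rfl, fun h => absurd h zero_ne_one⟩
    by_cases hs1 : s = 1
    · subst hs1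
      exact ⟨y, fun _ => ⟨hy, hγ1.symm⟩, fun h => absurd h one_ne_zero, fun _ => rfl⟩
    by_cases hs : s ∈ Icc (0 : ℝ) 1
    · obtain ⟨X, hX⟩ := hinv t₀ h₀ (γ s) (hγC hs)
      exact ⟨X, fun _ => hX, fun h => absurd h hs0, fun h => absurd h hs1⟩
    · exact ⟨x, fun h => absurd h hs, fun h => absurd h hs0, fun h => absurd h hs1⟩
  choose X hX hX0 hX1 using hsol
  -- With this `η` the loss `η (t₁ - t₀)` is at most `1`, which costs only the factor `Real.exp 1`
  -- in `K`, whatever the length of the interval.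
  have hη : 0 < 1 / (t₁ - t₀ + 1) := by
    have : 0 < t₁ - t₀ + 1 := by linarith
    positivity
  have hη1 : 1 / (t₁ - t₀ + 1) * (t₁ - t₀) ≤ 1 := by
    rw [one_div_mul_eq_div, div_le_one (by linarith)]
    linarith
  have key := norm_sub_le_of_eventually_norm_sub_le (F := fun s => X s t₁) (L := M * G)
    zero_le_one fun s hs => by
    obtain ⟨δ, hδ, hloc⟩ := h.exists_local_contraction h₀ h₁ ht₁ (hX s hs).1 hη
    have hγc : ∀ᶠ u in 𝓝[Icc 0 1] s, ‖γ u - γ s‖ < δ := by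
      have := Metric.tendsto_nhds.1 (hγ.continuousOn s hs) δ hδ
      simpa only [dist_eq_norm] using this
    filter_upwards [hγc, self_mem_nhdsWithin] with u hu hu01
    have h2 := hloc (X u) (hX u hu01).1 (by rwa [(hX u hu01).2, (hX s hs).2])
    rw [(hX u hu01).2, (hX s hs).2] at h2
    calc ‖X u t₁ - X s t₁‖ ≤ D * N t₁ (X u t₁ - X s t₁) := (hND t₁ (h₀.le.trans h₁) _).1
      _ ≤ D * (Real.exp (accumulated α β S t₀ (t₁ - t₀) + 1) * (D * (G * ‖u - s‖))) := by
          gcongr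
          refine h2.trans ?_
          gcongr
          exact ((hND t₀ h₀ _).2).trans (by gcongr; exact hγlip s hs u hu01)
      _ = M * G * ‖u - s‖ := by rw [hM]; ring
  simp only [hX0 0 rfl, hX1 1 rfl, sub_zero, mul_one] at key
  rw [norm_sub_rev]
  refine key.trans_eq ?_
  rw [hM, hG, Real.exp_add]
  ring

/-! ### The accumulated growth -/

theorem LocallyFiniteTimes.finite_inter_Ioo {S : Set ℝ} (hS : LocallyFiniteTimes S) {a b : ℝ}
    (ha : 0 ≤ a) : (S ∩ Ioo a b).Finite :=
  (hS b).subset (inter_subset_inter_right _ fun _ hx => ⟨ha.trans hx.1.le, hx.2.le⟩)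

theorem intervalIntegrable_of_nonneg (hα : LocallyIntegrableOn α (Ici 0) volume) {a b : ℝ}
    (ha : 0 ≤ a) (hab : a ≤ b) : IntervalIntegrable α volume a b :=
  (intervalIntegrable_iff_integrableOn_Icc_of_le hab).2
    (hα.integrableOn_compact_subset (fun _ ht => ha.trans ht.1) isCompact_Icc)

theorem accumulated_bddAbove (hα : LocallyIntegrableOn α (Ici 0) volume)
    (hS : LocallyFiniteTimes S) (β : ℝ → ℝ) {t₀ : ℝ} (h₀ : 0 ≤ t₀) (T₀ : ℝ) :
    ∃ M, ∀ T ∈ Icc 0 T₀, accumulated α β S t₀ T ≤ M := by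
  refine ⟨(∫ t in t₀..(t₀ + T₀), |α t|) + ∑ᶠ τ ∈ S ∩ Ioo t₀ (t₀ + T₀), |Real.log (β τ)|,
    fun T hT => add_le_add ?_ ?_⟩
  · have h1 : t₀ ≤ t₀ + T := by linarith [hT.1]
    have h2 : t₀ + T ≤ t₀ + T₀ := by linarith [hT.2]
    calc (∫ t in t₀..(t₀ + T), α t) ≤ ∫ t in t₀..(t₀ + T), |α t| :=
          (le_abs_self _).trans (intervalIntegral.abs_integral_le_integral_abs h1)
      _ ≤ ∫ t in t₀..(t₀ + T₀), |α t| :=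
          intervalIntegral.integral_mono_interval le_rfl h1 h2
            (Eventually.of_forall fun _ => abs_nonneg _)
            (intervalIntegrable_of_nonneg hα h₀ (h1.trans h2)).abs
  · have hf := hS.finite_inter_Ioo h₀ (b := t₀ + T)
    have hf' := hS.finite_inter_Ioo h₀ (b := t₀ + T₀)
    rw [finsum_mem_eq_finite_toFinset_sum _ hf, finsum_mem_eq_finite_toFinset_sum _ hf']
    refine (Finset.sum_le_sum fun τ _ => le_abs_self _).trans
      (Finset.sum_le_sum_of_subset_of_nonneg (fun τ hτ => ?_) fun _ _ _ => abs_nonneg _)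
    rw [Finite.mem_toFinset] at hτ ⊢
    exact ⟨hτ.1, hτ.2.1, hτ.2.2.trans_le (by linarith [hT.2])⟩

/-- The integrals add up exactly. The only defect is a jump at `b` itself, which lies in `(a, c)`
but in neither of the open intervals `(a, b)` and `(b, c)`. -/
theorem abs_accumulated_sub_le (hα : LocallyIntegrableOn α (Ici 0) volume)
    (hS : LocallyFiniteTimes S) (β : ℝ → ℝ) {a b c : ℝ} (ha : 0 ≤ a) (hab : a ≤ b) (hbc : b ≤ c) :
    |accumulated α β S a (c - a) - accumulated α β S a (b - a) - accumulated α β S b (c - b)| ≤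
      |Real.log (β b)| := by
  rcases hab.eq_or_lt with rfl | hab'
  · simp [accumulated_zero]
  rcases hbc.eq_or_lt with rfl | hbc'
  · simp [accumulated_zero]
  have hb := ha.trans hab
  simp only [accumulated, add_sub_cancel]
  have hint := intervalIntegral.integral_add_adjacent_intervals
    (intervalIntegrable_of_nonneg hα ha hab) (intervalIntegrable_of_nonneg hα hb hbc)
  have hf := hS.finite_inter_Ioo ha (b := b)
  have hf' := hS.finite_inter_Ioo hb (b := c)
  have hunion : S ∩ Ioo a c = S ∩ Ioo a b ∪ S ∩ Ico b c := by
    rw [← inter_union_distrib_left, Ioo_union_Ico_eq_Ioo hab' hbc]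
  have hfb : (S ∩ Ico b c).Finite :=
    (hS c).subset (inter_subset_inter_right _ fun _ hx => ⟨hb.trans hx.1, hx.2.le⟩)
  have hsum := finsum_mem_union (f := fun τ => Real.log (β τ))
    (Set.disjoint_left.2 fun τ (hτ : τ ∈ S ∩ Ioo a b) (hτ' : τ ∈ S ∩ Ico b c) =>
      absurd hτ.2.2 (not_lt.2 hτ'.2.1)) hf hfb
  rw [← hunion] at hsum
  have hIco : Ico b c = insert b (Ioo b c) := (Ioo_insert_left hbc').symm
  by_cases hbS : b ∈ S
  · have h1 : S ∩ Ico b c = insert b (S ∩ Ioo b c) := by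
      rw [hIco, inter_insert_of_mem hbS]
    rw [h1, finsum_mem_insert _ (fun h => lt_irrefl b h.2.1) hf'] at hsum
    rw [hsum, ← hint]
    refine le_of_eq (congrArg _ ?_)
    ring
  · have h1 : S ∩ Ico b c = S ∩ Ioo b c := by rw [hIco, inter_insert_of_notMem hbS]
    rw [h1] at hsum
    rw [hsum, ← hint]
    refine le_trans (le_of_eq ?_) (abs_nonneg _)
    rw [abs_eq_zero]
    ring

theorem AverageCond.accumulated_lt {c T₀ t₀ : ℝ} (h : AverageCond α β S c T₀ t₀) (hT₀ : 0 < T₀)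
    {T : ℝ} (hT : T₀ < T) : accumulated α β S t₀ T < -c * T := by
  have := h T hT
  rwa [one_div_mul_eq_div, div_lt_iff₀ (hT₀.trans hT)] at this

theorem AverageCond.accumulated_le {c T₀ t₀ M : ℝ} (h : AverageCond α β S c T₀ t₀) (hT₀ : 0 < T₀)
    (hc : 0 < c) (hM : ∀ T ∈ Icc 0 T₀, accumulated α β S t₀ T ≤ M) {T : ℝ} (hT : 0 ≤ T) :
    accumulated α β S t₀ T ≤ max M 0 + c * T₀ - c * T := by
  rcases le_or_gt T T₀ with hTT | hTT
  · have h1 := hM T ⟨hT, hTT⟩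
    have h2 := le_max_left M 0
    have h3 : c * T ≤ c * T₀ := by gcongr
    linarith
  · have h1 := h.accumulated_lt hT₀ hTT
    have h2 := le_max_right M 0
    have h3 : 0 ≤ c * T₀ := by positivity
    linarith

/-- A linear upper bound of the accumulated growth does not depend on the initial time, up to an
additive constant. -/
theorem exists_accumulated_le_of_accumulated_le (hα : LocallyIntegrableOn α (Ici 0) volume)
    (hS : LocallyFiniteTimes S) {β : ℝ → ℝ} {a b c M : ℝ} (hc : 0 < c) (ha : 0 ≤ a) (hb : 0 ≤ b)
    (h : ∀ T ≥ 0, accumulated α β S a T ≤ M - c * T) :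
    ∃ M', ∀ T ≥ 0, accumulated α β S b T ≤ M' - c * T := by
  rcases le_total a b with hab | hab
  · refine ⟨M - c * (b - a) - accumulated α β S a (b - a) + |Real.log (β b)|, fun T hT => ?_⟩
    have h1 := (abs_le.1 (abs_accumulated_sub_le hα hS β ha hab (le_add_of_nonneg_right hT))).1
    have h2 := h (b + T - a) (by linarith)
    rw [add_sub_cancel_left] at h1
    linarith
  -- When `b` precedes `a`, durations up to `a - b` are covered by local boundedness; longer ones
  -- pass through `a`.
  · obtain ⟨M₁, hM₁⟩ := accumulated_bddAbove hα hS β hb (a - b)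
    refine ⟨max (M₁ + c * (a - b)) (accumulated α β S b (a - b) + M + c * (a - b) +
      |Real.log (β a)|), fun T hT => ?_⟩
    rcases le_total T (a - b) with hTT | hTT
    · have h1 := hM₁ T ⟨hT, hTT⟩
      have h2 : c * T ≤ c * (a - b) := by gcongr
      have h3 := le_max_left (M₁ + c * (a - b)) (accumulated α β S b (a - b) + M + c * (a - b) +
        |Real.log (β a)|)
      linarith
    · have h1 := (abs_le.1 (abs_accumulated_sub_le hα hS β hb hab
        (by linarith : a ≤ b + T))).2
      have h2 := h (b + T - a) (by linarith)
      rw [add_sub_cancel_left] at h1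
      have h3 := le_max_right (M₁ + c * (a - b)) (accumulated α β S b (a - b) + M + c * (a - b) +
        |Real.log (β a)|)
      linarith

/-! ### Stability -/

/-- Times in `S` are reached as limits from the right of times outside `S`, using continuity of the
solutions and of `exp (M - c T)`; the bound on `Λ` is inserted before the limit is taken. -/
theorem expEstimate_of_accumulated_le (hS : LocallyFiniteTimes S) {K c M T₁ t₀ : ℝ}
    (hK : 0 < K) (hT₁ : 0 ≤ T₁) (h₀ : 0 ≤ t₀)
    (hest : ∀ t₁ ≥ t₀, t₁ ∉ S → ∀ x y, IsSolution C f r t₀ x → IsSolution C f r t₀ y →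
      ‖x t₁ - y t₁‖ ≤ K * Real.exp (accumulated α β S t₀ (t₁ - t₀)) * ‖x t₀ - y t₀‖)
    (hacc : ∀ T ≥ T₁, accumulated α β S t₀ T ≤ M - c * T) :
    ExpEstimate C f r (K * Real.exp M) c T₁ t₀ := by
  intro x y hx hy t ht
  have ht0 : t₀ ≤ t := by linarith
  have hcont : ∀ z, IsSolution C f r t₀ z → Tendsto z (𝓝[>] t) (𝓝 (z t)) := fun z hz =>
    (hz.continuousOn t ht0).mono_left (nhdsWithin_mono _ fun u hu => ht0.trans (le_of_lt hu))
  have hrhs : Tendsto (fun u => K * Real.exp M * Real.exp (-c * (u - t₀)) * ‖x t₀ - y t₀‖)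
      (𝓝[>] t) (𝓝 (K * Real.exp M * Real.exp (-c * (t - t₀)) * ‖x t₀ - y t₀‖)) :=
    (Continuous.tendsto (by fun_prop) t).mono_left nhdsWithin_le_nhds
  have hnotin : ∀ᶠ u in 𝓝[>] t, u ∉ S := by
    have hcl : IsClosed ((S ∩ Icc 0 (t + 1)) \ {t}) := ((hS (t + 1)).subset sdiff_subset).isClosed
    have h1 : ∀ᶠ u in 𝓝[>] t, u ∉ (S ∩ Icc 0 (t + 1)) \ {t} :=
      nhdsWithin_le_nhds (hcl.isOpen_compl.mem_nhds (by simp))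
    filter_upwards [h1, Ioo_mem_nhdsGT (lt_add_one t)] with u hu hut huS
    exact hu ⟨⟨huS, (h₀.trans ht0).trans hut.1.le, hut.2.le⟩, hut.1.ne'⟩
  refine le_of_tendsto_of_tendsto ((hcont x hx).sub (hcont y hy)).norm hrhs ?_
  filter_upwards [hnotin, self_mem_nhdsWithin] with u huS hu
  have hu : t < u := hu
  refine (hest u (ht0.trans hu.le) huS x y hx hy).trans ?_
  rw [mul_assoc K (Real.exp M), ← Real.exp_add]
  gcongr
  have := hacc (u - t₀) (by linarith)
  linarith

theorem isClassEKL_exp {K c : ℝ} (hK : 0 < K) (hc : 0 < c) :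
    IsClassEKL fun ρ t => K * Real.exp (-c * t) * ρ := by
  refine ⟨⟨by fun_prop, fun t _ => ⟨by fun_prop, fun a _ b _ hab => ?_, by simp⟩,
    fun ρ hρ s _ t _ hst => ?_, fun ρ _ => ?_⟩, c, hc, fun ρ _ => ?_⟩
  · change K * Real.exp (-c * t) * a < K * Real.exp (-c * t) * b
    gcongr
  · change K * Real.exp (-c * t) * ρ ≤ K * Real.exp (-c * s) * ρ
    gcongr K * Real.exp ?_ * ρ
    nlinarith
  · have h1 : Tendsto (fun t : ℝ => Real.exp (-c * t)) atTop (𝓝 0) :=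
      Real.tendsto_exp_atBot.comp (tendsto_id.const_mul_atTop_of_neg (neg_neg_of_pos hc))
    simpa using (h1.const_mul K).mul_const ρ
  · refine Asymptotics.IsBigO.of_bound ‖K * ρ‖ (Eventually.of_forall fun t => le_of_eq ?_)
    rw [← norm_mul]
    congr 1
    ring

theorem ExpEstimate.incrementalBound {K c t₀ : ℝ} (h : ExpEstimate C f r K c 0 t₀) :
    IncrementalBound C f r (normSeminorm ℝ (State n)) (fun ρ t => K * Real.exp (-c * t) * ρ) t₀ :=
  fun x y hx hy t ht => by
    simpa using h x y hx hy (t₀ + t) (by linarith)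

theorem isNorm_normSeminorm : IsNorm (normSeminorm ℝ (State n)) :=
  fun _ hx => norm_eq_zero.1 hx

end SwitchedContraction

end

open SwitchedContraction
theorem theorem1 (n : ℕ) (C : Set (SwitchedContraction.State n))
    (f : SwitchedContraction.State n → ℝ → SwitchedContraction.State n)
    (J : SwitchedContraction.State n → ℝ →
      (SwitchedContraction.State n →L[ℝ] SwitchedContraction.State n))
    (r : ℝ → ℝ) (N : ℝ → Seminorm ℝ (SwitchedContraction.State n)) (S : Set ℝ)
    (α β : ℝ → ℝ)
    (hr : SwitchedContraction.IsPWC r)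
    (hf : SwitchedContraction.FieldHyp C f J r)
    (hN : SwitchedContraction.NormHyp N S)
    (hreach : ∃ κ > 0, ∀ t₀, 0 ≤ t₀ → SwitchedContraction.IsKappaReachable (N t₀) κ C)
    (hinv : SwitchedContraction.ForwardInvariant C f r)
    (hα : LocallyIntegrableOn α (Ici 0) volume)
    (hν : ∀ t, 0 ≤ t → t ∉ S → ∀ x ∈ C,
      SwitchedContraction.switchedMeasure N t (J x (r t)) ≤ (α t : EReal))
    (hβ₀ : ∀ τ ∈ S, 0 ≤ β τ)
    (hβ : ∀ τ ∈ S, 0 < τ → ∀ x, N τ x ≤ β τ * SwitchedContraction.leftNorm N τ x) :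
    -- stability, under the average condition at one initial time
    ((∃ t₀ ≥ 0, ∃ c > 0, ∃ T₀ > 0, SwitchedContraction.AverageCond α β S c T₀ t₀) →
      SwitchedContraction.DeltaEAS C f r) ∧
    -- its rate
    (∀ t₀ ≥ 0, ∀ c > 0, ∀ T₀ > 0, SwitchedContraction.AverageCond α β S c T₀ t₀ →
      ∃ K > 0, SwitchedContraction.ExpEstimate C f r K c 0 t₀) ∧
    -- the average condition uniformly in the initial time
    (∀ c > 0, ∀ T₀ > 0, (∀ t₀ ≥ 0, SwitchedContraction.AverageCond α β S c T₀ t₀) →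
      (∃ K > 0, ∀ T₁ > T₀, ∀ t₀ ≥ 0, SwitchedContraction.ExpEstimate C f r K c T₁ t₀) ∧
      ((∃ M : ℝ, ∀ t₀ ≥ 0, ∀ T ∈ Icc 0 T₀, SwitchedContraction.accumulated α β S t₀ T ≤ M) →
        SwitchedContraction.DeltaUEAS C f r ∧
        ∃ K > 0, ∀ t₀ ≥ 0, SwitchedContraction.ExpEstimate C f r K c 0 t₀)) := by
  obtain ⟨κ, hκ, hreach⟩ := hreach
  obtain ⟨D, hD, hND⟩ := hN.exists_equiv
  have H : ContractionHyp C f J r N S α β (D * κ * D) :=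
    ⟨hr, hf, hN, by positivity, (hreach 0 le_rfl).euclidean hD hκ (hND 0 le_rfl), hα, hν, hβ₀, hβ⟩
  obtain ⟨K, hK, hest⟩ := H.exists_contraction hinv
  have hrate : ∀ t₀ ≥ 0, ∀ c, (∃ M, ∀ T ≥ 0, accumulated α β S t₀ T ≤ M - c * T) →
      ∃ K > 0, ExpEstimate C f r K c 0 t₀ := fun t₀ h₀ c ⟨M, hM⟩ =>
    ⟨K * Real.exp M, by positivity,
      expEstimate_of_accumulated_le hN.jumps hK le_rfl h₀ (hest t₀ h₀) hM⟩
  have hlinear : ∀ t₀ ≥ 0, ∀ c > 0, ∀ T₀ > 0, AverageCond α β S c T₀ t₀ →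
      ∃ M, ∀ T ≥ 0, accumulated α β S t₀ T ≤ M - c * T := fun t₀ h₀ c hc T₀ hT₀ hav => by
    obtain ⟨M, hM⟩ := accumulated_bddAbove hα hN.jumps β h₀ T₀
    exact ⟨_, fun T hT => hav.accumulated_le hT₀ hc hM hT⟩
  refine ⟨?_, fun t₀ h₀ c hc T₀ hT₀ hav => hrate t₀ h₀ c (hlinear t₀ h₀ c hc T₀ hT₀ hav),
    fun c hc T₀ hT₀ hav => ⟨⟨K * Real.exp 0, by positivity, fun T₁ hT₁ t₀ h₀ => ?_⟩, ?_⟩⟩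
  · rintro ⟨t₀, h₀, c, hc, T₀, hT₀, hav⟩
    obtain ⟨M, hM⟩ := hlinear t₀ h₀ c hc T₀ hT₀ hav
    refine ⟨normSeminorm ℝ _, isNorm_normSeminorm, fun s hs => ?_⟩
    obtain ⟨K', hK', hexp⟩ := hrate s hs c
      (exists_accumulated_le_of_accumulated_le hα hN.jumps hc h₀ hs hM)
    exact ⟨_, isClassEKL_exp hK' hc, hexp.incrementalBound⟩
  -- Past `T₀` the average condition alone gives `Λ ≤ -c T`, so `M = 0` works and `K` does not
  -- depend on `t₀` or `T₁`.
  · refine expEstimate_of_accumulated_le hN.jumps hK (hT₀.le.trans hT₁.le) h₀ (hest t₀ h₀)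
      fun T hT => ?_
    have := (hav t₀ h₀).accumulated_lt hT₀ (hT₁.trans_le hT)
    linarith
  · rintro ⟨M, hM⟩
    have hexp : ∀ t₀ ≥ 0, ExpEstimate C f r (K * Real.exp (max M 0 + c * T₀)) c 0 t₀ :=
      fun t₀ h₀ => expEstimate_of_accumulated_le hN.jumps hK le_rfl h₀ (hest t₀ h₀)
        fun T hT => (hav t₀ h₀).accumulated_le hT₀ hc (hM t₀ h₀) hT
    have hpos : 0 < K * Real.exp (max M 0 + c * T₀) := by positivity
    exact ⟨⟨normSeminorm ℝ _, isNorm_normSeminorm, _, isClassEKL_exp hpos hc,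
      fun t₀ h₀ => (hexp t₀ h₀).incrementalBound⟩, _, hpos, hexp⟩
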